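/- All logarithms are to base $2$. **Random graphs.** For $n,k\in\mathbb N$ and $p\in[0,1]$ let $\mathcal G(n,k,p)$ be the random $k$-partite graph with vertices $v_{i,a}$ ($1\le i\le k$, $0\le a<n$), with blocks $V_i=\{v_{i,a} : 0\le a<n\}$, in which each pair of vertices from two distinct blocks is an edge independently with probability $p$ and there are no edges inside the blocks. **Binary clique formula.** For such a graph $G$ let $\mathrm{Clique}_{\mathrm{bin}}(G,k)$ be the following CNF formula over the variables $x_{i,b}$, $1\le i\le k$, $1\le b\le\lceil\log n\rceil$. For $0\le a<2^{\lceil\log n\rceil}$ with binary digits $a_1,\dots,a_{\lceil \log n\rceil}$ put $C_{i,a}=\bigvee_{b:a_b=0}x_{i,b}\vee\bigvee_{b:a_b=1}\bar x_{i,b}$. The clauses of the formula are $C_{i,a}\vee C_{j,b}$ for all $i\ne j$ and $0\le a,b<n$ with $\{v_{i,a},v_{j,b}\}\notin E(G)$, and $C_{i,a}$ for all $i$ and $n\le a<2^{\lceil\log n\rceil}$ (there are none of the latter if $n$ is a power of two). It is satisfiable if and only if $G$ contains a $k$-clique. **Tree-like $\mathrm{Th}(d)$.** Let $A$ be a CNF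 formula over the variables $x_1,\dots,x_N$. A $\mathrm{Th}(d)$ refutation of $A$ is a sequence of polynomial inequalities $p\ge 0$ with $p\in\mathbb Z[x_1,\dots,x_N]$ of degree at most $d$, the last of which is $-1\ge 0$, such that each is either the translation $\sum_{i\in I}x_i+\sum_{j\in J}(1-x_j)-1\ge 0$ of a clause $\bigvee_{i\in I}x_i\vee\bigvee_{j\in J}\bar x_j$ of $A$, or is implied, over all assignments in $\{0,1\}^N$, by at most two earlier lines of the sequence, its premises. Its length is the number of lines. It is tree-like if every line is used as a premise of at most one inference. **Theorem.** 1. There is a constant $c>0$ such that the following holds. Let $D=D(n)$ and $k=k(n)$ be integers with $1\le D\le 2\log n$ for all large $n$ and $k=\Theta(D)$. Then for $G\sim\mathcal G(n,k,n^{-2/D})$, with probability tending to $1$ as $n\to\infty$, every tree-like $\mathrm{Th}\bigl(\lfloor\frac{\log n}{2\log\log n}\rfloor\bigr)$ refutation of $\mathrm{Clique}_{\mathrm{bin}}(G,k)$ has length at least $n^{cD}$. 2. Let $0<\varepsilon<1$, $D=\lceil(\log n)^{\varepsilon}\rceil$ and $k=2D$, and let $N=k\lceil\log n\rceil$ be the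 number of variables of $\mathrm{Clique}_{\mathrm{bin}}(G,k)$. Then for every $s\in\mathbb N$ and for $G\sim\mathcal G(n,k,n^{-2/D})$, with probability tending to $1$ as $n\to\infty$, the formula $A=\mathrm{Clique}_{\mathrm{bin}}(G,k)$ is unsatisfiable and, for every integer $0\le d\le N^{1-\varepsilon}$, every tree-like $\mathrm{Th}(d)$ refutation of $A$ has length at least $|A|^{s}$, where $|A|$ is the total number of literal occurrences in $A$. -/

import Mathlib

open Filter Topology Asymptotics

namespace CliqueTh

/-! ### Clauses and CNF formulas -/

/-- A literal over the variables `V`: `(x, true)` is `x`, and `(x, false)` is its negation. -/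
abbrev Literal (V : Type) := V × Bool

/-- A clause is the disjunction of a finite set of literals. -/
abbrev Clause (V : Type) := Finset (Literal V)

/-- A CNF formula is the conjunction of a set of clauses (the axioms). -/
abbrev CNF (V : Type) := Set (Clause V)

/-- The assignment `α` satisfies the clause `C`. -/
def Clause.IsSatisfiedBy {V : Type} (C : Clause V) (α : V → Bool) : Prop :=
  ∃ l ∈ C, α l.1 = l.2

/-- Some assignment satisfies all clauses of `A`. -/
def CNF.Satisfiable {V : Type} (A : CNF V) : Prop :=
  ∃ α : V → Bool, ∀ C ∈ A, Clause.IsSatisfiedBy C α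

open Classical in
/-- The size of a CNF formula: the total number of literal occurrences in its clauses. -/
noncomputable def CNF.size {V : Type} [Fintype V] (A : CNF V) : ℕ :=
  ∑ C : Clause V with C ∈ A, C.card

/-! ### The semantic threshold proof system `Th(d)` -/

/-- The Boolean assignment `α` satisfies the polynomial inequality `p ≥ 0`. -/
def Holds {V : Type} (p : MvPolynomial V ℤ) (α : V → Bool) : Prop :=
  0 ≤ MvPolynomial.eval (fun v => if α v then (1 : ℤ) else 0) p

/-- The polynomial `p` such that `p ≥ 0` is the usual translation
`∑ x_i + ∑ (1 - x_j) ≥ 1` of a clause with positive literals `x_i` and negative literals `¬ x_j`. -/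
noncomputable def clausePoly {V : Type} (C : Clause V) : MvPolynomial V ℤ :=
  (∑ l ∈ C, if l.2 then MvPolynomial.X l.1 else 1 - MvPolynomial.X l.1) - 1

/-- Tree-like semantic `Th(d)` refutations of the CNF formula `A`. The `i`-th line is the polynomial
inequality `line i ≥ 0`, and `premises i` is the set of (at most two) earlier lines from which it is
inferred (this set is irrelevant if the line is an axiom). -/
structure TreeLikeThRefutation {V : Type} (d : ℕ) (A : CNF V) where
  /-- the number of lines -/
  length : ℕ
  /-- the proof lines -/
  line : Fin length → MvPolynomial V ℤ
  /-- the premises of each line -/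
  premises : Fin length → Finset (Fin length)
  /-- lines have degree at most `d` -/
  degree_le : ∀ i, (line i).totalDegree ≤ d
  /-- premises are earlier lines -/
  premises_lt : ∀ i, ∀ j ∈ premises i, j < i
  /-- there are at most two premises -/
  card_premises_le : ∀ i, (premises i).card ≤ 2
  /-- each line is an axiom or a consequence, over Boolean assignments, of its premises -/
  valid : ∀ i, (∃ C ∈ A, line i = clausePoly C) ∨
    ∀ α : V → Bool, (∀ j ∈ premises i, Holds (line j) α) → Holds (line i) α
  /-- each line is a premise of at most one inference -/
  tree_like : ∀ i i' j, j ∈ premises i → j ∈ premises i' → i = i'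
  /-- there is a last line -/
  length_pos : 0 < length
  /-- the last line is the contradiction `0 ≥ 1`, that is, `-1 ≥ 0` -/
  line_last : line ⟨length - 1, Nat.sub_lt length_pos Nat.one_pos⟩ = -1

/-! ### The binary clique formula -/

/-- The variables `x_{i,b}`, for a block `i` and a bit position `b` among `⌈log₂ n⌉` many. -/
abbrev BVar (k n : ℕ) := Fin k × Fin (Nat.clog 2 n)

/-- The clause that is falsified exactly if the variables of block `i` are the binary digits of `a`:
it contains `x_{i,b}` if the `b`-th digit is `0` and `¬ x_{i,b}` if it is `1`. -/
def codeClause {k n : ℕ} (i : Fin k) (a : ℕ) : Clause (BVar k n) :=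
  Finset.univ.image fun b : Fin (Nat.clog 2 n) => ((i, b), !a.testBit b)

/-- For each non-adjacent pair `(i, a)`, `(j, b)` of vertices in distinct blocks, a clause that
forbids to choose `a` in block `i` and `b` in block `j`. -/
def edgeAxioms {k n : ℕ} (G : SimpleGraph (Fin k × Fin n)) : CNF (BVar k n) :=
  {C | ∃ (i j : Fin k) (a b : Fin n), i ≠ j ∧ ¬ G.Adj (i, a) (j, b) ∧
    C = codeClause i a ∪ codeClause j b}

/-- For each block and each bit string that is not the code of a vertex, a clause that forbids it.
There are no such bit strings if `n` is a power of two. -/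
def rangeAxioms (k n : ℕ) : CNF (BVar k n) :=
  {C | ∃ (i : Fin k) (a : ℕ), n ≤ a ∧ a < 2 ^ Nat.clog 2 n ∧ C = codeClause i a}

/-- The binary encoding of the claim that the `k`-partite graph `G` with blocks
`{i} × Fin n` has a `k`-clique. -/
def binaryClique {k n : ℕ} (G : SimpleGraph (Fin k × Fin n)) : CNF (BVar k n) :=
  edgeAxioms G ∪ rangeAxioms k n

/-! ### The random graph `G(n, k, n^(-2/D))` -/

/-- The distribution `G(n, k, p)`: sample a binomial (Erdős–Rényi) random graph with edge
probability `p` on `k` blocks of `n` vertices, and delete the edges inside the blocks. -/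
noncomputable def randomPartite (n k : ℕ) (p : unitInterval) :
    MeasureTheory.Measure (SimpleGraph (Fin k × Fin n)) :=
  (SimpleGraph.binomialRandom (Fin k × Fin n) p).map
    fun G => G ⊓ SimpleGraph.completeEquipartiteGraph k n

theorem edgeProb_mem (n D : ℕ) : (n : ℝ) ^ (-2 / (D : ℝ)) ∈ unitInterval := by
  refine ⟨by positivity, ?_⟩
  rcases Nat.eq_zero_or_pos n with rfl | hn
  · simpa using Real.zero_rpow_le_one (-2 / (D : ℝ))
  · refine Real.rpow_le_one_of_one_le_of_nonpos (by exact_mod_cast hn) ?_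
    exact div_nonpos_of_nonpos_of_nonneg (by norm_num) (by positivity)

/-- The edge probability `n^(-2/D)`. -/
noncomputable def edgeProb (n D : ℕ) : unitInterval := ⟨(n : ℝ) ^ (-2 / (D : ℝ)), edgeProb_mem n D⟩

end CliqueTh

/-! A choice of one vertex per block is a point of `Fin k → Fin n`, coded by a Boolean assignment,
and each line of a `Th(d)` refutation cuts out a threshold set of such points. Three facts are
combined.

Balancing: a tree-like refutation with at most (3/2)^H lines gives a decision tree of depth H that
queries threshold sets and at each leaf has found a falsified clause, that is, a non-edge chosen by
all points arriving there (`TreeLikeThRefutation.solves`).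

Counting: with M multilinear monomials of degree at most d, the VC dimension of the threshold sets
is at most M, so by Sauer-Shelah there are at most (n^k + 1)^M of them (`card_thresholdSets_le`).

Adversary: if G is good, an adversary survives H queries (`IsGood.not_solves`). It keeps a set Y of
choices that agree, and form a clique, on a set I of fixed blocks, and that is spread: fixing
further blocks shrinks Y by a factor of about l per block. Such a Y forces no non-edge. After a
query the larger half is kept, then a fiber on which the fixed blocks J carry a clique and the
potential l^|J| * |fiber| is maximal, and finally the heavy elements are deleted. The potential
loses at most a factor 4 per round. The only obstacle is a critical state, in which at least half of
the elements are heavy although none of their extensions lies in G.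

For random G, Janson's inequality makes this obstacle very unlikely (`IsCritical.prob_le`): two
choices agreeing on g new blocks share at most g * |J| edges, which raises their joint probability
by at most p^(-g|J|) ≤ q^g, while spreadness makes the agreement rarer by l^(-g). Reachable states
are defined without reference to G, so a union bound over them applies. With y = n^(1/10), l = y^9,
q = y, M ≤ y^6 and H about D log n / 400, the Janson exponent, y^8 up to powers of log n, beats the
logarithm of the number of states, y^6 up to powers of log n. In the second statement,
unsatisfiability is a first moment bound, and n^(D/1600) exceeds every fixed power of the formula
size because D tends to infinity. -/

/-! ### Random subsets of a finite set and Janson's inequality -/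

namespace RandomSubset

variable {E : Type*} [Fintype E] [DecidableEq E]

/-- The probability of the outcome `R` if each `e` is taken independently with probability `p e`. -/
noncomputable def weight (p : E → ℝ) (R : Finset E) : ℝ :=
  ∏ e, if e ∈ R then p e else 1 - p e

theorem weight_nonneg {p : E → ℝ} (hp : ∀ e, 0 ≤ p e ∧ p e ≤ 1) (R : Finset E) :
    0 ≤ weight p R := by
  refine Finset.prod_nonneg fun e _ => ?_
  split_ifs
  · exact (hp e).1
  · linarith [(hp e).2]

theorem sum_weight (p : E → ℝ) : ∑ R, weight p R = 1 := by
  have h := Finset.prod_add p (fun e => 1 - p e) (Finset.univ : Finset E)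
  simp only [add_sub_cancel, Finset.prod_const_one] at h
  rw [h, Finset.powerset_univ]
  refine Finset.sum_congr rfl fun R _ => ?_
  rw [weight, Finset.prod_ite]
  congr 1
  · exact Finset.prod_congr (by ext; simp) fun _ _ => rfl
  · exact Finset.prod_congr (by ext; simp) fun _ _ => rfl

/-- The weight of a set, with the factor of the element `e` left out. -/
noncomputable def restWeight (p : E → ℝ) (e : E) (R : Finset E) : ℝ :=
  ∏ e' ∈ Finset.univ.erase e, if e' ∈ R then p e' else 1 - p e'

theorem restWeight_nonneg {p : E → ℝ} (hp : ∀ e, 0 ≤ p e ∧ p e ≤ 1) (e : E) (R : Finset E) :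
    0 ≤ restWeight p e R := by
  refine Finset.prod_nonneg fun e _ => ?_
  split_ifs
  · exact (hp e).1
  · linarith [(hp e).2]

theorem weight_of_notMem (p : E → ℝ) {e : E} {R : Finset E} (h : e ∉ R) :
    weight p R = (1 - p e) * restWeight p e R := by
  rw [weight, ← Finset.mul_prod_erase _ _ (Finset.mem_univ e), if_neg h, restWeight]

theorem weight_insert (p : E → ℝ) (e : E) (R : Finset E) :
    weight p (insert e R) = p e * restWeight p e R := by
  rw [weight, ← Finset.mul_prod_erase _ _ (Finset.mem_univ e), if_pos (Finset.mem_insert_self e R),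
    restWeight]
  congr 1
  refine Finset.prod_congr rfl fun e' he' => ?_
  simp [Finset.ne_of_mem_erase he']

theorem sum_eq_sum_insert (e : E) (f : Finset E → ℝ) :
    ∑ R, f R = ∑ R ∈ (Finset.univ.erase e).powerset, (f R + f (insert e R)) := by
  rw [← Finset.powerset_univ, ← Finset.insert_erase (Finset.mem_univ e),
    Finset.sum_powerset_insert (Finset.notMem_erase e _), ← Finset.sum_add_distrib]
  simp

/-- Pairing `R` with `insert e R` leaves the difference p(1 - p) * `restWeight` * (g R - g (insert e
R)) for each pair, which is nonnegative. -/
theorem sum_mem_le {p : E → ℝ} (hp : ∀ e, 0 ≤ p e ∧ p e ≤ 1) (e : E) (g : Finset E → ℝ)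
    (hg : ∀ R, e ∉ R → g (insert e R) ≤ g R) :
    ∑ R, weight p R * (if e ∈ R then g R else 0) ≤ p e * ∑ R, weight p R * g R := by
  rw [sum_eq_sum_insert e, sum_eq_sum_insert e (fun R => weight p R * g R), Finset.mul_sum]
  refine Finset.sum_le_sum fun R hR => ?_
  have he : e ∉ R := fun h => by simpa using Finset.mem_powerset.1 hR h
  rw [if_neg he, if_pos (Finset.mem_insert_self e R), weight_insert, weight_of_notMem p he]
  have h1 := mul_nonneg (mul_nonneg (hp e).1 (sub_nonneg.2 (hp e).2)) (restWeight_nonneg hp e R)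
  nlinarith [mul_le_mul_of_nonneg_left (hg R he) h1]

theorem sum_mem_eq (p : E → ℝ) (e : E) (g : Finset E → ℝ)
    (hg : ∀ R, e ∉ R → g (insert e R) = g R) :
    ∑ R, weight p R * (if e ∈ R then g R else 0) = p e * ∑ R, weight p R * g R := by
  rw [sum_eq_sum_insert e, sum_eq_sum_insert e (fun R => weight p R * g R), Finset.mul_sum]
  refine Finset.sum_congr rfl fun R hR => ?_
  have he : e ∉ R := fun h => by simpa using Finset.mem_powerset.1 hR h
  rw [if_neg he, if_pos (Finset.mem_insert_self e R), weight_insert, weight_of_notMem p he, hg R he]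
  ring

/-- Harris' inequality for the increasing event `S ⊆ R` and a decreasing function. -/
theorem sum_subset_le {p : E → ℝ} (hp : ∀ e, 0 ≤ p e ∧ p e ≤ 1) (S : Finset E) (g : Finset E → ℝ)
    (hg : ∀ e R, g (insert e R) ≤ g R) :
    ∑ R, weight p R * (if S ⊆ R then g R else 0) ≤ (∏ e ∈ S, p e) * ∑ R, weight p R * g R := by
  induction S using Finset.induction_on with
  | empty => simp
  | insert e S he ih =>
    rw [Finset.prod_insert he, mul_assoc]
    refine le_trans ?_ (mul_le_mul_of_nonneg_left ih (hp e).1)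
    -- The condition `S ⊆ R` does not involve `e ∉ S`, so the product of its indicator with `g` is
    -- still decreasing in the coordinate `e`.
    refine le_trans (le_of_eq ?_) (sum_mem_le hp e (fun R => if S ⊆ R then g R else 0) ?_)
    · refine Finset.sum_congr rfl fun R _ => ?_
      simp only [Finset.insert_subset_iff, ite_and]
    · intro R _
      simp only [Finset.subset_insert_iff_of_notMem he]
      split_ifs
      · exact hg e R
      · exact le_rfl

theorem sum_subset_eq (p : E → ℝ) (S : Finset E) (g : Finset E → ℝ)
    (hg : ∀ e ∈ S, ∀ R, g (insert e R) = g R) :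
    ∑ R, weight p R * (if S ⊆ R then g R else 0) = (∏ e ∈ S, p e) * ∑ R, weight p R * g R := by
  induction S using Finset.induction_on with
  | empty => simp
  | insert e S he ih =>
    rw [Finset.prod_insert he, mul_assoc, ← ih fun e' he' => hg e' (Finset.mem_insert_of_mem he'),
      ← sum_mem_eq p e (fun R => if S ⊆ R then g R else 0)]
    · refine Finset.sum_congr rfl fun R _ => ?_
      simp only [Finset.insert_subset_iff, ite_and]
    · intro R _
      simp only [Finset.subset_insert_iff_of_notMem he, hg e (Finset.mem_insert_self e S)]

open Classical in
/-- The probability of the event `A`. -/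
noncomputable def prob (p : E → ℝ) (A : Finset E → Prop) : ℝ :=
  ∑ R, weight p R * if A R then 1 else 0

theorem prob_nonneg {p : E → ℝ} (hp : ∀ e, 0 ≤ p e ∧ p e ≤ 1) (A : Finset E → Prop) :
    0 ≤ prob p A :=
  Finset.sum_nonneg fun R _ => mul_nonneg (weight_nonneg hp R) (by split_ifs <;> norm_num)

theorem prob_mono {p : E → ℝ} (hp : ∀ e, 0 ≤ p e ∧ p e ≤ 1) {A B : Finset E → Prop}
    (h : ∀ R, A R → B R) : prob p A ≤ prob p B := by
  refine Finset.sum_le_sum fun R _ => mul_le_mul_of_nonneg_left ?_ (weight_nonneg hp R)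
  by_cases hA : A R
  · simp [hA, h R hA]
  · rw [if_neg hA]; split_ifs <;> norm_num

theorem prob_le_one {p : E → ℝ} (hp : ∀ e, 0 ≤ p e ∧ p e ≤ 1) (A : Finset E → Prop) :
    prob p A ≤ 1 := by
  rw [← sum_weight p]
  refine Finset.sum_le_sum fun R _ => ?_
  split_ifs <;> simp [weight_nonneg hp R]

theorem prob_subset (p : E → ℝ) (S : Finset E) : prob p (fun R => S ⊆ R) = ∏ e ∈ S, p e := by
  have h := sum_subset_eq p S (fun _ => 1) (fun _ _ _ => rfl)
  rw [prob]
  simp only [mul_one, sum_weight] at h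
  convert h

/-- The probability that no member of `L` is a subset shrinks by a definite factor if a further set
`S` is taken into account. -/
theorem prob_none_cons_le {p : E → ℝ} (hp : ∀ e, 0 ≤ p e ∧ p e ≤ 1) (S : Finset E)
    (L : List (Finset E)) :
    prob p (fun R => ∀ S' ∈ S :: L, ¬ S' ⊆ R) ≤
      prob p (fun R => ∀ S' ∈ L, ¬ S' ⊆ R) *
        Real.exp (-(∏ e ∈ S, p e) +
          (L.map fun S' => if Disjoint S' S then 0 else ∏ e ∈ S ∪ S', p e).sum) := by
  classical
  set P := ∏ e ∈ S, p e
  set Δ := (L.map fun S' => if Disjoint S' S then 0 else ∏ e ∈ S ∪ S', p e).sum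
  set N : Finset E → Prop := fun R => ∀ S' ∈ L, ¬ S' ⊆ R
  -- `C` keeps only the part of `N` that is independent of `S ⊆ R`; it is implied by `N`, and it is
  -- a decreasing event.
  set C : Finset E → Prop := fun R => ∀ S' ∈ L, Disjoint S' S → ¬ S' ⊆ R
  have hN0 := prob_nonneg hp N
  have hNC : prob p N ≤ prob p C := prob_mono hp fun R h S' hS' _ => h S' hS'
  have hle : prob p (fun R => ∀ S' ∈ S :: L, ¬ S' ⊆ R) ≤ prob p N :=
    prob_mono hp fun R h S' hS' => h S' (List.mem_cons_of_mem _ hS')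
  rcases le_or_gt P Δ with hP | hP
  · refine hle.trans (le_mul_of_one_le_right hN0 (Real.one_le_exp (by linarith)))
  have hsplit : prob p (fun R => ∀ S' ∈ S :: L, ¬ S' ⊆ R) =
      prob p N - prob p (fun R => S ⊆ R ∧ N R) := by
    rw [prob, prob, prob, ← Finset.sum_sub_distrib]
    refine Finset.sum_congr rfl fun R _ => ?_
    rw [← mul_sub]
    congr 1
    have hcons : (∀ S' ∈ S :: L, ¬ S' ⊆ R) ↔ ¬ S ⊆ R ∧ N R := List.forall_mem_cons
    by_cases h1 : S ⊆ R <;> by_cases h2 : N R <;> simp only [hcons, h1, h2] <;> simp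
  have hand : ∀ S, prob p (fun R => S ⊆ R ∧ C R) =
      ∑ R, weight p R * (if S ⊆ R then (if C R then 1 else 0) else 0) := fun S =>
    Finset.sum_congr rfl fun R _ => by by_cases h1 : S ⊆ R <;> by_cases h2 : C R <;> simp [h1, h2]
  have hC : prob p (fun R => S ⊆ R ∧ C R) = P * prob p C := by
    have h := sum_subset_eq p S (fun R => if C R then 1 else 0) ?_
    · rw [hand, h]
      exact congrArg _ (Finset.sum_congr rfl fun R _ => by by_cases h2 : C R <;> simp only [h2])
    · intro e he R
      have : C (insert e R) ↔ C R := by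
        refine forall₂_congr fun S' _ => forall_congr' fun hd => not_congr ?_
        exact Finset.subset_insert_iff_of_notMem fun h => Finset.disjoint_left.1 hd h he
      simp only [this]
  have hdep : ∀ S', prob p (fun R => S ∪ S' ⊆ R ∧ C R) ≤ (∏ e ∈ S ∪ S', p e) * prob p C := by
    intro S'
    have h := sum_subset_le hp (S ∪ S') (fun R => if C R then 1 else 0) ?_
    · rw [hand]
      refine h.trans (le_of_eq (congrArg _ (Finset.sum_congr rfl fun R _ => ?_)))
      by_cases h2 : C R <;> simp only [h2]
    · intro e R
      have : C (insert e R) → C R :=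
        fun h S' hS' hd hs => h S' hS' hd (hs.trans (Finset.subset_insert e R))
      by_cases h1 : C (insert e R)
      · simp [h1, this h1]
      · simp only [h1, if_false]
        split_ifs <;> norm_num
  -- The members of `L` that meet `S` are added back one at a time. By Harris' inequality each costs
  -- at most the probability of `S ∪ S' ⊆ R` times that of `C`.
  have hunion : ∀ L' : List (Finset E), (∀ S' ∈ L', S' ∈ L) →
      prob p (fun R => S ⊆ R ∧ C R) ≤ prob p (fun R => S ⊆ R ∧ C R ∧ ∀ S' ∈ L', ¬ S' ⊆ R) +
        (L'.map fun S' => if Disjoint S' S then 0 else ∏ e ∈ S ∪ S', p e).sum * prob p C := by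
    intro L'
    induction L' with
    | nil => intro _; simp
    | cons S' L' ih =>
      intro hL'
      have ih' := ih fun S'' h => hL' S'' (List.mem_cons_of_mem _ h)
      have hstep : prob p (fun R => S ⊆ R ∧ C R ∧ ∀ S' ∈ L', ¬ S' ⊆ R) ≤
          prob p (fun R => S ⊆ R ∧ C R ∧ ∀ S'' ∈ S' :: L', ¬ S'' ⊆ R) +
          (if Disjoint S' S then 0 else ∏ e ∈ S ∪ S', p e) * prob p C := by
        by_cases hd : Disjoint S' S
        · simp only [hd, if_true, zero_mul, add_zero]
          refine prob_mono hp fun R h => ⟨h.1, h.2.1, fun S'' hS'' => ?_⟩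
          rcases List.mem_cons.1 hS'' with rfl | h'
          · exact h.2.1 _ (hL' _ List.mem_cons_self) hd
          · exact h.2.2 _ h'
        · simp only [hd, if_false]
          refine le_trans ?_ (add_le_add_right (hdep S') _)
          rw [prob, prob, prob, ← Finset.sum_add_distrib]
          refine Finset.sum_le_sum fun R _ => ?_
          rw [← mul_add]
          refine mul_le_mul_of_nonneg_left ?_ (weight_nonneg hp R)
          by_cases h0 : S ⊆ R ∧ C R ∧ ∀ S' ∈ L', ¬ S' ⊆ R
          · rw [if_pos h0]
            by_cases h1 : S' ⊆ R
            · rw [if_pos (show S ∪ S' ⊆ R ∧ C R from ⟨Finset.union_subset h0.1 h1, h0.2.1⟩)]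
              split_ifs <;> norm_num
            · rw [if_pos (show S ⊆ R ∧ C R ∧ ∀ S'' ∈ S' :: L', ¬ S'' ⊆ R from
                ⟨h0.1, h0.2.1, List.forall_mem_cons.2 ⟨h1, h0.2.2⟩⟩)]
              split_ifs <;> norm_num
          · rw [if_neg h0]
            split_ifs <;> norm_num
      simp only [List.map_cons, List.sum_cons, add_mul]
      linarith
  have h1 := hunion L fun _ h => h
  have h2 : prob p (fun R => S ⊆ R ∧ C R ∧ ∀ S' ∈ L, ¬ S' ⊆ R) ≤ prob p (fun R => S ⊆ R ∧ N R) :=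
    prob_mono hp fun R h => ⟨h.1, h.2.2⟩
  -- Together with `h1` and `h2`, the event `S ⊆ R ∧ N R` has probability at least (P - Δ) prob C,
  -- hence at least (P - Δ) prob N. Replacing `C` by `N` needs `Δ < P`.
  have h3 : (P - Δ) * prob p N ≤ (P - Δ) * prob p C :=
    mul_le_mul_of_nonneg_left hNC (by linarith)
  have h4 : 1 + (-P + Δ) ≤ Real.exp (-P + Δ) := by
    linarith [Real.add_one_le_exp (-P + Δ)]
  have h5 := mul_le_mul_of_nonneg_left h4 hN0
  rw [hsplit]
  rw [hC] at h1
  nlinarith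

/-- **Janson's inequality** for a family of equally likely sets such that, for each of them, the
average dependence on the other ones is at most `ρ`. -/
theorem prob_none_le_exp {p : E → ℝ} (hp : ∀ e, 0 ≤ p e ∧ p e ≤ 1) {X : Type*} (Z : Finset X)
    (hZ : Z.Nonempty) (S : X → Finset E) {P ρ : ℝ} (hP : 0 < P) (hρ : 0 < ρ)
    (hS : ∀ x ∈ Z, ∏ e ∈ S x, p e = P)
    (hrow : ∀ x ∈ Z, ∑ y ∈ Z, (if Disjoint (S x) (S y) then 0 else ∏ e ∈ S x ∪ S y, p e) ≤
      ρ * P ^ 2 * Z.card) :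
    prob p (fun R => ∀ x ∈ Z, ¬ S x ⊆ R) ≤ Real.exp (1 / 2 - 1 / (2 * ρ)) := by
  classical
  rcases le_or_gt 1 ρ with hρ1 | hρ1
  · refine (prob_le_one hp _).trans (Real.one_le_exp ?_)
    rw [sub_nonneg]
    exact one_div_le_one_div_of_le (by norm_num) (by linarith)
  -- Greedy choice of s members, possibly with repetitions: by averaging, some next member has
  -- dependence at most s * ρP² on the s already chosen, and these bounds add up to at most ρP² *
  -- s²/2.
  have hseq : ∀ s : ℕ, ∃ L : List X, L.length = s ∧ (∀ x ∈ L, x ∈ Z) ∧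
      prob p (fun R => ∀ S' ∈ L.map S, ¬ S' ⊆ R) ≤
        Real.exp (-(s * P) + ρ * P ^ 2 * (s ^ 2 / 2)) := by
    intro s
    induction s with
    | zero => exact ⟨[], rfl, by simp, by simpa using prob_le_one hp _⟩
    | succ s ih =>
      obtain ⟨L, hL, hLZ, hprob⟩ := ih
      obtain ⟨y, hy, hle⟩ : ∃ y ∈ Z, (L.map fun x =>
          if Disjoint (S x) (S y) then 0 else ∏ e ∈ S x ∪ S y, p e).sum ≤ s * (ρ * P ^ 2) := by
        refine Finset.exists_le_of_sum_le hZ ?_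
        rw [Finset.sum_const, nsmul_eq_mul]
        have hsum : ∀ L : List X, (∀ x ∈ L, x ∈ Z) → ∑ y ∈ Z, (L.map fun x =>
            if Disjoint (S x) (S y) then 0 else ∏ e ∈ S x ∪ S y, p e).sum ≤
            Z.card * (L.length * (ρ * P ^ 2)) := by
          intro L
          induction L with
          | nil => intro _; simp
          | cons x L ih =>
            intro h
            simp only [List.map_cons, List.sum_cons, Finset.sum_add_distrib, List.length_cons]
            have h1 := ih fun x hx => h x (List.mem_cons_of_mem _ hx)
            have h2 := hrow x (h x List.mem_cons_self)
            push_cast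
            nlinarith
        simpa [hL] using hsum L hLZ
      refine ⟨y :: L, by simp [hL], ?_, ?_⟩
      · intro x hx
        rcases List.mem_cons.1 hx with rfl | h
        exacts [hy, hLZ x h]
      · have h := prob_none_cons_le hp (S y) (L.map S)
        rw [← List.map_cons] at h
        refine h.trans ((mul_le_mul_of_nonneg_right hprob (Real.exp_pos _).le).trans ?_)
        rw [← Real.exp_add, Real.exp_le_exp, hS y hy, List.map_map]
        have h1 : (L.map ((fun S' => if Disjoint S' (S y) then 0 else ∏ e ∈ S y ∪ S', p e) ∘ S)).sum
            ≤ s * (ρ * P ^ 2) := by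
          convert hle using 4 with x
          simp [Finset.union_comm]
        have h2 : 0 ≤ ρ * P ^ 2 := by positivity
        push_cast
        nlinarith
  -- The exponent is minimal at s = 1/(ρP). Rounding up moves sP by at most P ≤ 1, which costs at
  -- most ρ/2 < 1/2 once the square is completed.
  obtain ⟨L, -, hLZ, hprob⟩ := hseq ⌈1 / (ρ * P)⌉₊
  have hP1 : P ≤ 1 := by
    obtain ⟨x, hx⟩ := hZ
    rw [← hS x hx]
    exact Finset.prod_le_one (fun e _ => (hp e).1) fun e _ => (hp e).2
  have hmono : prob p (fun R => ∀ x ∈ Z, ¬ S x ⊆ R) ≤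
      prob p (fun R => ∀ S' ∈ L.map S, ¬ S' ⊆ R) := by
    refine prob_mono hp fun R h S' hS' => ?_
    obtain ⟨x, hx, rfl⟩ := List.mem_map.1 hS'
    exact h x (hLZ x hx)
  refine hmono.trans (hprob.trans (Real.exp_le_exp.2 ?_))
  set s : ℝ := (⌈1 / (ρ * P)⌉₊ : ℝ)
  have hs1 : 1 / ρ ≤ s * P := by
    have := mul_le_mul_of_nonneg_right (Nat.le_ceil (1 / (ρ * P))) hP.le
    refine le_trans (le_of_eq ?_) this
    field_simp
  have hs2 : s * P ≤ 1 / ρ + 1 := by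
    have := mul_le_mul_of_nonneg_right (Nat.ceil_lt_add_one (show 0 ≤ 1 / (ρ * P) by positivity)).le
      hP.le
    refine this.trans ?_
    rw [add_mul, one_mul]
    refine add_le_add (le_of_eq ?_) hP1
    field_simp
  set t := s * P
  have ht : -(s * P) + ρ * P ^ 2 * (s ^ 2 / 2) = ρ / 2 * (t - 1 / ρ) ^ 2 - 1 / (2 * ρ) := by
    simp only [t]
    field_simp
    ring
  rw [ht]
  have : (t - 1 / ρ) ^ 2 ≤ 1 := by
    rw [sq_le_one_iff_abs_le_one, abs_le]
    constructor <;> linarith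
  nlinarith

end RandomSubset

/-! ### The number of polynomial threshold functions -/

namespace CliqueTh

theorem sum_choose_le_pow (N M : ℕ) : ∑ i ∈ Finset.Iic M, N.choose i ≤ (N + 1) ^ M := by
  rw [add_pow, Nat.range_succ_eq_Iic]
  refine Finset.sum_le_sum fun i hi => (Nat.choose_le_pow N i).trans ?_
  rw [one_pow, mul_one]
  exact Nat.le_mul_of_pos_right _ (Nat.choose_pos (Finset.mem_Iic.1 hi))

theorem card_support_le_degree {V : Type} (f : V →₀ ℕ) : f.support.card ≤ f.sum fun _ e => e := by
  rw [Finsupp.sum, Finset.card_eq_sum_ones]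
  exact Finset.sum_le_sum fun v hv => Nat.one_le_iff_ne_zero.2 (Finsupp.mem_support_iff.1 hv)

variable {V : Type} [Fintype V] [DecidableEq V]

/-- The sets of at most `d` variables, that is, the multilinear monomials of degree at most `d`. -/
def lowDegreeMonomials (V : Type) [Fintype V] [DecidableEq V] (d : ℕ) : Finset (Finset V) :=
  Finset.univ.filter fun S => S.card ≤ d

theorem eval_bool_monomial (f : V →₀ ℕ) (α : V → Bool) :
    (f.prod fun v e => (if α v then (1 : ℤ) else 0) ^ e) =
      if ∀ v ∈ f.support, α v then 1 else 0 := by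
  split_ifs with h
  · exact Finset.prod_eq_one fun v hv => by simp [h v hv]
  · push Not at h
    obtain ⟨v, hv, hα⟩ := h
    refine Finset.prod_eq_zero hv ?_
    simp [hα, Finsupp.mem_support_iff.1 hv]

variable {X : Type*} [Fintype X] [DecidableEq X]

open Classical in
/-- The subsets of `X` that are cut out by polynomial inequalities of degree at most `d`, where the
elements of `X` are encoded as Boolean assignments. -/
noncomputable def thresholdSets (enc : X → V → Bool) (d : ℕ) : Finset (Finset X) :=
  Finset.univ.filter fun s =>
    ∃ p : MvPolynomial V ℤ, p.totalDegree ≤ d ∧ ∀ x, x ∈ s ↔ Holds p (enc x)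

/-- More points than monomials have linearly dependent vectors of monomial values, say with
coefficients `c`, one of them positive. Every admissible polynomial then satisfies ∑ c_x p(x) = 0,
but a polynomial that is nonnegative exactly at the points with `c ≤ 0` makes all terms nonpositive
and one negative. -/
theorem card_le_of_shatters_thresholdSets {enc : X → V → Bool} {d : ℕ} {s : Finset X}
    (hs : (thresholdSets enc d).Shatters s) : s.card ≤ (lowDegreeMonomials V d).card := by
  classical
  by_contra! hlt
  let φ : X → (lowDegreeMonomials V d → ℤ) := fun x S => if ∀ v ∈ S.1, enc x v then 1 else 0
  have hdep : ¬ LinearIndependent ℤ (fun x : s => φ x) := fun h => by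
    have := h.fintype_card_le_finrank
    simp only [Fintype.card_coe, Module.finrank_fintype_fun_eq_card] at this
    omega
  obtain ⟨c, hc, x₁, hx₁⟩ := Fintype.not_linearIndependent_iff.1 hdep
  wlog hpos : 0 < c x₁ generalizing c with H
  · refine H (-c) ?_ (by simpa using hx₁) ?_
    · simpa using congrArg Neg.neg hc
    · simp only [Pi.neg_apply]
      omega
  obtain ⟨t, ht, htx⟩ := hs.subset_iff.1 (Finset.filter_subset
    (fun x => ∀ h : x ∈ s, c ⟨x, h⟩ ≤ 0) s)
  obtain ⟨p, hpd, hp⟩ := (Finset.mem_filter.1 ht).2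
  have hmem : ∀ x : s, x.1 ∈ t ↔ c x ≤ 0 := by
    intro x
    have := Finset.ext_iff.1 htx x.1
    simpa using this
  have heval : ∑ x : s, c x * MvPolynomial.eval (fun v => if enc x v then (1 : ℤ) else 0) p = 0 := by
    simp only [MvPolynomial.eval_eq, Finset.mul_sum]
    rw [Finset.sum_comm]
    refine Finset.sum_eq_zero fun f hf => ?_
    have hfd : f.support ∈ lowDegreeMonomials V d :=
      Finset.mem_filter.2 ⟨Finset.mem_univ _, (card_support_le_degree f).trans
        ((MvPolynomial.le_totalDegree hf).trans hpd)⟩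
    have h0 := congrFun hc ⟨f.support, hfd⟩
    simp only [Finset.sum_apply, Pi.smul_apply, smul_eq_mul, Pi.zero_apply, φ] at h0
    refine Eq.trans ?_ ((congrArg (p.coeff f * ·) h0).trans (mul_zero _))
    simp only [Finset.mul_sum]
    refine Finset.sum_congr rfl fun x _ => ?_
    have := eval_bool_monomial f (enc x)
    rw [Finsupp.prod] at this
    rw [this]
    ring
  have hneg : ∀ x : s, c x * MvPolynomial.eval (fun v => if enc x v then (1 : ℤ) else 0) p ≤ 0 := by
    intro x
    rcases le_or_gt (c x) 0 with h | h
    · exact mul_nonpos_of_nonpos_of_nonneg h ((hp x.1).1 ((hmem x).2 h))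
    · refine mul_nonpos_of_nonneg_of_nonpos h.le (not_le.1 fun h' => ?_).le
      exact absurd ((hmem x).1 ((hp x.1).2 h')) (not_le.2 h)
  have hlt : MvPolynomial.eval (fun v => if enc x₁ v then (1 : ℤ) else 0) p < 0 := by
    refine not_le.1 fun h' => ?_
    exact absurd ((hmem x₁).1 ((hp x₁.1).2 h')) (not_le.2 hpos)
  have := Finset.sum_lt_sum (fun x _ => hneg x) ⟨x₁, Finset.mem_univ _, mul_neg_of_pos_of_neg hpos hlt⟩
  rw [heval, Finset.sum_const_zero] at this
  exact lt_irrefl _ this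

/-- Sauer-Shelah. Only the coded points `X` enter the base of the power, not all Boolean
assignments. -/
theorem card_thresholdSets_le (enc : X → V → Bool) (d : ℕ) :
    (thresholdSets enc d).card ≤ (Fintype.card X + 1) ^ (lowDegreeMonomials V d).card := by
  have hvc : (thresholdSets enc d).vcDim ≤ (lowDegreeMonomials V d).card :=
    Finset.sup_le fun s hs => card_le_of_shatters_thresholdSets (Finset.mem_shatterer.1 hs)
  refine (Finset.card_le_card_shatterer _).trans (Finset.card_shatterer_le_sum_vcDim.trans ?_)
  exact (Finset.sum_le_sum_of_subset (Finset.Iic_subset_Iic.2 hvc)).trans (sum_choose_le_pow _ _)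

end CliqueTh

/-! ### Balancing tree-like refutations -/

namespace CliqueTh

theorem holds_clausePoly {V : Type} (C : Clause V) (α : V → Bool) :
    Holds (clausePoly C) α ↔ C.IsSatisfiedBy α := by
  have h : ∀ l : Literal V, MvPolynomial.eval (fun v => if α v then (1 : ℤ) else 0)
      (if l.2 then MvPolynomial.X l.1 else 1 - MvPolynomial.X l.1) =
      if α l.1 = l.2 then 1 else 0 := by
    rintro ⟨v, b⟩
    cases b <;> cases h : α v <;> simp [h]
  rw [Holds, clausePoly, map_sub, map_sum, map_one, sub_nonneg]
  simp only [h]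
  constructor
  · intro hle
    by_contra hC
    rw [Finset.sum_eq_zero] at hle
    · exact absurd hle (by norm_num)
    · intro l hl
      exact if_neg fun h => hC ⟨l, hl, h⟩
  · rintro ⟨l, hl, hα⟩
    refine le_trans (le_of_eq (if_pos hα).symm)
      (Finset.single_le_sum (f := fun l : Literal V => if α l.1 = l.2 then (1 : ℤ) else 0) ?_ hl)
    intro l _
    split_ifs <;> norm_num

/-- A decision tree of depth `h` whose queries are membership in sets of `B` classifies the elements
of `Y` so that every leaf satisfies `Leaf`. -/
def Solves {X : Type*} [DecidableEq X] (B : Finset (Finset X)) (Leaf : Finset X → Prop) :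
    ℕ → Finset X → Prop
  | 0, Y => Leaf Y
  | h + 1, Y => ∃ Q ∈ B, Solves B Leaf h (Y ∩ Q) ∧ Solves B Leaf h (Y \ Q)

theorem Solves.mono {X : Type*} [DecidableEq X] {B : Finset (Finset X)}
    {Leaf Leaf' : Finset X → Prop} (hL : ∀ Y, Leaf Y → Leaf' Y) {h : ℕ} {Y : Finset X}
    (hY : Solves B Leaf h Y) : Solves B Leaf' h Y := by
  induction h generalizing Y with
  | zero => exact hL Y hY
  | succ h ih =>
    obtain ⟨Q, hQ, h1, h2⟩ := hY
    exact ⟨Q, hQ, ih h1, ih h2⟩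

theorem solves_empty {X : Type*} [DecidableEq X] {B : Finset (Finset X)} (hB : B.Nonempty)
    {Leaf : Finset X → Prop} (hL : Leaf ∅) (h : ℕ) : Solves B Leaf h ∅ := by
  induction h with
  | zero => exact hL
  | succ h ih =>
    obtain ⟨Q, hQ⟩ := hB
    exact ⟨Q, hQ, by simpa using ih, by simpa using ih⟩

variable {V : Type} {X : Type*} [Fintype X]

/-- All elements of `Y` falsify the same clause of `A`. -/
def FalsifiesClause (A : CNF V) (enc : X → V → Bool) (Y : Finset X) : Prop :=
  Y = ∅ ∨ ∃ C ∈ A, ∀ x ∈ Y, ¬ Clause.IsSatisfiedBy C (enc x)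

namespace TreeLikeThRefutation

variable {d : ℕ} {A : CNF V} (π : TreeLikeThRefutation d A)

/-- The line `i` is used, possibly through other lines, in the derivation of the line `j`. -/
def Below (i j : Fin π.length) : Prop :=
  Relation.ReflTransGen (fun u w => u ∈ π.premises w) i j

theorem Below.exists_premise {π : TreeLikeThRefutation d A} {i j : Fin π.length}
    (h : π.Below i j) : i = j ∨ ∃ w ∈ π.premises j, π.Below i w := by
  rcases Relation.ReflTransGen.cases_tail h with h | ⟨w, h1, h2⟩
  · exact Or.inl h.symm
  · exact Or.inr ⟨w, h2, h1⟩

open Classical in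
/-- The part of `T` that is used in the derivation of the line `v`. -/
noncomputable def part (T : Finset (Fin π.length)) (v : Fin π.length) : Finset (Fin π.length) :=
  T.filter fun u => π.Below u v

theorem mem_part {T : Finset (Fin π.length)} {u v : Fin π.length} :
    u ∈ π.part T v ↔ u ∈ T ∧ π.Below u v := by
  simp [part]

theorem card_part_le (T : Finset (Fin π.length)) (v : Fin π.length) {b : ℕ}
    (hb : ∀ w ∈ π.premises v, (π.part T w).card ≤ b) : (π.part T v).card ≤ 1 + 2 * b := by
  classical
  have hsub : π.part T v ⊆ {v} ∪ (π.premises v).biUnion fun w => π.part T w := by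
    intro u hu
    rw [mem_part] at hu
    rcases hu.2.exists_premise with h | ⟨w, hw, h⟩
    · simp [h]
    · exact Finset.mem_union_right _ (Finset.mem_biUnion.2 ⟨w, hw, π.mem_part.2 ⟨hu.1, h⟩⟩)
  refine (Finset.card_le_card hsub).trans ((Finset.card_union_le _ _).trans ?_)
  rw [Finset.card_singleton]
  refine Nat.add_le_add_left (Finset.card_biUnion_le.trans ?_) 1
  refine (Finset.sum_le_sum hb).trans ?_
  rw [Finset.sum_const, smul_eq_mul]
  exact Nat.mul_le_mul_right b (π.card_premises_le v)

variable (enc : X → V → Bool)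

open Classical in
/-- The elements of `X` that satisfy the line `i`. -/
noncomputable def lineSet (i : Fin π.length) : Finset X :=
  Finset.univ.filter fun x => Holds (π.line i) (enc x)

theorem mem_lineSet {i : Fin π.length} {x : X} : x ∈ π.lineSet enc i ↔ Holds (π.line i) (enc x) := by
  simp [lineSet]

theorem lineSet_mem [DecidableEq X] [Fintype V] [DecidableEq V] (i : Fin π.length) :
    π.lineSet enc i ∈ thresholdSets enc d := by
  simp only [thresholdSets, Finset.mem_filter]
  exact ⟨Finset.mem_univ _, π.line i, π.degree_le i, fun x => π.mem_lineSet enc⟩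

/-- A part of a refutation with `m` lines yields a decision tree of depth `log_{3/2} m` for the
search problem. -/
theorem solves_of_part [DecidableEq X] [Fintype V] [DecidableEq V] (h : ℕ) (T : Finset (Fin π.length))
    (r : Fin π.length) (Y : Finset X) (hrT : r ∈ T) (hTr : ∀ u ∈ T, π.Below u r)
    (hT : ∀ u ∈ T, ∀ w, π.Below u w → π.Below w r → w ∈ T)
    (hr : ∀ x ∈ Y, x ∉ π.lineSet enc r)
    (hprem : ∀ u ∈ T, ∀ w ∈ π.premises u, w ∉ T → ∀ x ∈ Y, x ∈ π.lineSet enc w)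
    (hcard : T.card * 2 ^ h < 3 ^ h + 2 ^ h) :
    Solves (thresholdSets enc d) (FalsifiesClause A enc) h Y := by
  classical
  induction h generalizing T r Y with
  | zero =>
    have hT1 : T = {r} := by
      have h1 : T.card ≤ 1 := by simpa [Nat.lt_succ_iff] using hcard
      exact (Finset.eq_singleton_iff_unique_mem.2 ⟨hrT, fun u hu => Finset.card_le_one.1 h1 u hu r hrT⟩)
    rcases π.valid r with ⟨C, hC, hline⟩ | himp
    · refine Or.inr ⟨C, hC, fun x hx hsat => hr x hx ?_⟩
      rw [mem_lineSet, hline, holds_clausePoly]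
      exact hsat
    · refine Or.inl (Finset.eq_empty_of_forall_notMem fun x hx => hr x hx ?_)
      rw [mem_lineSet]
      refine himp _ fun w hw => (π.mem_lineSet enc).1 (hprem r hrT w hw ?_ x hx)
      rw [hT1, Finset.mem_singleton]
      exact (π.premises_lt r w hw).ne
  | succ h ih =>
    have hself : π.part T r = T := by
      ext u
      rw [mem_part]
      exact ⟨fun h => h.1, fun h => ⟨h, hTr u h⟩⟩
    -- The minimal `v` whose part has at least a third of `T` is a balanced cut: the parts of its at
    -- most two premises are each smaller than a third.
    have hex : (T.filter fun v => T.card ≤ 3 * (π.part T v).card).Nonempty :=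
      ⟨r, Finset.mem_filter.2 ⟨hrT, by rw [hself]; omega⟩⟩
    obtain ⟨v, hv, hmin⟩ := Finset.exists_min_image _ id hex
    rw [Finset.mem_filter] at hv
    have hsmall : ∀ w ∈ π.premises v, 3 * (π.part T w).card + 1 ≤ T.card := by
      intro w hw
      by_contra! hlt
      have hne : (π.part T w).card ≠ 0 := by
        intro h0
        have : 0 < T.card := Finset.card_pos.2 ⟨r, hrT⟩
        omega
      obtain ⟨u, hu⟩ := Finset.card_ne_zero.1 hne
      rw [mem_part] at hu
      have hwT : w ∈ T := hT u hu.1 w hu.2 (Relation.ReflTransGen.head hw (hTr v hv.1))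
      have := hmin w (Finset.mem_filter.2 ⟨hwT, by omega⟩)
      exact absurd (π.premises_lt v w hw) (not_lt.2 this)
    have hpart : (π.part T v).card * 3 ≤ 2 * T.card + 1 := by
      have h1 := π.card_part_le T v (b := (T.card - 1) / 3) fun w hw => by
        have := hsmall w hw
        omega
      have : 0 < T.card := Finset.card_pos.2 ⟨r, hrT⟩
      omega
    have hrest : (T \ π.part T v).card * 3 ≤ 2 * T.card := by
      have hsub : π.part T v ⊆ T := fun u hu => (π.mem_part.1 hu).1
      rw [Finset.card_sdiff_of_subset hsub]
      omega
    have hpos := Nat.pos_of_ne_zero (pow_ne_zero h (two_ne_zero (α := ℕ)))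
    -- The size hypothesis says |T| - 1 < (3/2)^h. Subtracting 1 makes the recursion exact, since
    -- `hpart` reads 3(|part| - 1) ≤ 2(|T| - 1).
    rw [pow_succ, pow_succ] at hcard
    -- Where the line `v` holds, its derivation is cut off and `v` becomes a true premise; where it
    -- fails, the search continues in its derivation with `v` as the new false root.
    refine ⟨_, π.lineSet_mem enc v, ?_, ?_⟩
    · by_cases hvr : v = r
      · have : Y ∩ π.lineSet enc v = ∅ := by
          refine Finset.eq_empty_of_forall_notMem fun x hx => ?_
          rw [Finset.mem_inter, hvr] at hx
          exact hr x hx.1 hx.2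
        rw [this]
        exact solves_empty ⟨_, π.lineSet_mem enc v⟩ (Or.inl rfl) h
      · refine ih (T \ π.part T v) r _ ?_ ?_ ?_ ?_ ?_ ?_
        · rw [Finset.mem_sdiff, mem_part]
          refine ⟨hrT, fun hb => hvr ?_⟩
          have hle : ∀ {a b : Fin π.length}, π.Below a b → a ≤ b := by
            intro a b hab
            induction hab with
            | refl => exact le_rfl
            | tail _ h ih => exact ih.trans (π.premises_lt _ _ h).le
          exact le_antisymm (hle (hTr v hv.1)) (hle hb.2)
        · exact fun u hu => hTr u (Finset.mem_sdiff.1 hu).1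
        · intro u hu w huw hwr
          rw [Finset.mem_sdiff, mem_part] at hu ⊢
          exact ⟨hT u hu.1 w huw hwr, fun hw => hu.2 ⟨hu.1, huw.trans hw.2⟩⟩
        · exact fun x hx => hr x (Finset.mem_inter.1 hx).1
        · intro u hu w hw hwT x hx
          rw [Finset.mem_inter] at hx
          rw [Finset.mem_sdiff] at hu hwT
          by_cases hwT' : w ∈ T
          · have hwv : w ∈ π.part T v := by
              by_contra h'
              exact hwT ⟨hwT', h'⟩
            have := (π.mem_part.1 hwv).2
            -- Tree-likeness is needed here: a removed line other than `v` is already a premise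
            -- inside the part of `v`, so it cannot also be a premise of a remaining line.
            rcases Relation.ReflTransGen.cases_head this with h' | ⟨u', h1, h2⟩
            · rw [h']; exact hx.2
            · obtain rfl := π.tree_like u u' w hw h1
              exact absurd (π.mem_part.2 ⟨hu.1, h2⟩) hu.2
          · exact hprem u hu.1 w hw hwT' x hx.1
        · nlinarith
    · refine ih (π.part T v) v _ ?_ ?_ ?_ ?_ ?_ ?_
      · exact π.mem_part.2 ⟨hv.1, Relation.ReflTransGen.refl⟩
      · exact fun u hu => (π.mem_part.1 hu).2
      · intro u hu w huw hwv
        rw [mem_part] at hu ⊢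
        exact ⟨hT u hu.1 w huw (hwv.trans (hTr v hv.1)), hwv⟩
      · exact fun x hx => (Finset.mem_sdiff.1 hx).2
      · intro u hu w hw hwT x hx
        rw [mem_part] at hu
        refine hprem u hu.1 w hw (fun hwT' => hwT ?_) x (Finset.mem_sdiff.1 hx).1
        exact π.mem_part.2 ⟨hwT', Relation.ReflTransGen.head hw hu.2⟩
      · nlinarith

theorem solves [DecidableEq X] [Fintype V] [DecidableEq V] (h : ℕ) (hcard : π.length * 2 ^ h < 3 ^ h + 2 ^ h) :
    Solves (thresholdSets enc d) (FalsifiesClause A enc) h (Finset.univ : Finset X) := by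
  classical
  set r : Fin π.length := ⟨π.length - 1, Nat.sub_lt π.length_pos Nat.one_pos⟩ with hr
  have hrr : π.Below r r := Relation.ReflTransGen.refl
  refine π.solves_of_part enc h (π.part Finset.univ r) r Finset.univ ?_ ?_ ?_ ?_ ?_ ?_
  · exact π.mem_part.2 ⟨Finset.mem_univ _, hrr⟩
  · exact fun u hu => (π.mem_part.1 hu).2
  · exact fun u _ w _ hw => π.mem_part.2 ⟨Finset.mem_univ _, hw⟩
  · intro x _ hx
    rw [mem_lineSet, hr, π.line_last, Holds] at hx
    simp at hx
  · intro u hu w hw hwT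
    exact absurd (π.mem_part.2 ⟨Finset.mem_univ _,
      Relation.ReflTransGen.head hw (π.mem_part.1 hu).2⟩) hwT
  · refine lt_of_le_of_lt (Nat.mul_le_mul_right _ ?_) hcard
    exact (Finset.card_le_univ _).trans (Fintype.card_fin _).le

end TreeLikeThRefutation

end CliqueTh

/-! ### The adversary strategy -/

namespace CliqueTh

variable {k n : ℕ}

/-- The elements of `Y` that agree with `x` on the blocks in `J`. -/
def fiber (Y : Finset (Fin k → Fin n)) (J : Finset (Fin k)) (x : Fin k → Fin n) :
    Finset (Fin k → Fin n) :=
  Y.filter fun y => ∀ j ∈ J, y j = x j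

theorem mem_fiber {Y : Finset (Fin k → Fin n)} {J : Finset (Fin k)} {x y : Fin k → Fin n} :
    y ∈ fiber Y J x ↔ y ∈ Y ∧ ∀ j ∈ J, y j = x j :=
  Finset.mem_filter

theorem fiber_subset (Y : Finset (Fin k → Fin n)) (J : Finset (Fin k)) (x : Fin k → Fin n) :
    fiber Y J x ⊆ Y :=
  Finset.filter_subset _ _

theorem fiber_mono {Y Y' : Finset (Fin k → Fin n)} (h : Y ⊆ Y') (J : Finset (Fin k))
    (x : Fin k → Fin n) : fiber Y J x ⊆ fiber Y' J x :=
  Finset.filter_subset_filter _ h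

theorem fiber_fiber {Y : Finset (Fin k → Fin n)} {J J' : Finset (Fin k)} (h : J ⊆ J')
    {x y : Fin k → Fin n} (hy : y ∈ fiber Y J x) : fiber (fiber Y J x) J' y = fiber Y J' y := by
  ext z
  simp only [mem_fiber] at hy ⊢
  exact ⟨fun hz => ⟨hz.1.1, hz.2⟩,
    fun hz => ⟨⟨hz.1, fun j hj => (hz.2 j (h hj)).trans (hy.2 j hj)⟩, hz.2⟩⟩

/-- The elements of `Y` agree on the blocks in `I`. -/
def ConstantOn (Y : Finset (Fin k → Fin n)) (I : Finset (Fin k)) : Prop :=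
  ∀ x ∈ Y, ∀ y ∈ Y, ∀ i ∈ I, y i = x i

theorem ConstantOn.fiber_eq {Y : Finset (Fin k → Fin n)} {I : Finset (Fin k)}
    (h : ConstantOn Y I) {x : Fin k → Fin n} (hx : x ∈ Y) : fiber Y I x = Y :=
  Finset.filter_true_of_mem fun y hy => h x hx y hy

/-- Fixing further blocks of `Y` to any values reduces its size by a factor of at least `l` per
block, up to the factor `K`. -/
def IsSpread (l K : ℝ) (Y : Finset (Fin k → Fin n)) (I : Finset (Fin k)) : Prop :=
  ∀ x ∈ Y, ∀ J, I ⊆ J → l ^ J.card * (fiber Y J x).card ≤ K * (l ^ I.card * Y.card)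

/-- Fixing the blocks in `J` to their values in `x` reduces `Y` by a factor of less than `l` per
block outside of `I`. -/
def IsHeavy (l : ℝ) (Y : Finset (Fin k → Fin n)) (I J : Finset (Fin k)) (x : Fin k → Fin n) :
    Prop :=
  I ⊆ J ∧ l ^ I.card * Y.card < l ^ J.card * (fiber Y J x).card

open Classical in
/-- The elements of `Y` that violate spreadness with factor `1`. -/
noncomputable def heavyPart (l : ℝ) (Y : Finset (Fin k → Fin n)) (I : Finset (Fin k)) :
    Finset (Fin k → Fin n) :=
  Y.filter fun x => ∃ J, IsHeavy l Y I J x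

theorem mem_heavyPart {l : ℝ} {Y : Finset (Fin k → Fin n)} {I : Finset (Fin k)}
    {x : Fin k → Fin n} : x ∈ heavyPart l Y I ↔ x ∈ Y ∧ ∃ J, IsHeavy l Y I J x := by
  simp [heavyPart]

/-- The vertices chosen by `x` in the blocks of `J` form a clique. -/
def IsCliqueOn (G : SimpleGraph (Fin k × Fin n)) (J : Finset (Fin k)) (x : Fin k → Fin n) : Prop :=
  ∀ i ∈ J, ∀ j ∈ J, i ≠ j → G.Adj (i, x i) (j, x j)

/-- The edges that are needed to extend a clique in the blocks of `I` to the blocks of `J`, where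
the vertices are chosen by `x`. -/
def extensionEdges (I J : Finset (Fin k)) (x : Fin k → Fin n) : Finset (Sym2 (Fin k × Fin n)) :=
  ((J ×ˢ J).filter fun t => t.1 ≠ t.2 ∧ ¬ (t.1 ∈ I ∧ t.2 ∈ I)).image
    fun t => s((t.1, x t.1), (t.2, x t.2))

/-- From the states in `F`, make a query from `B` and fix some blocks. -/
def restrictions (B : Finset (Finset (Fin k → Fin n)))
    (F : Finset (Finset (Fin k → Fin n) × Finset (Fin k))) :
    Finset (Finset (Fin k → Fin n) × Finset (Fin k)) :=
  ((F ×ˢ B) ×ˢ (Finset.univ : Finset (Bool × Finset (Fin k) × (Fin k → Fin n)))).image fun t =>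
    (fiber (if t.2.1 then t.1.1.1 ∩ t.1.2 else t.1.1.1 \ t.1.2) t.2.2.1 t.2.2.2, t.2.2.1)

/-- The states that the adversary can be in after `r` queries: the set of choices that are still
possible, and the set of blocks whose vertex is fixed. -/
noncomputable def states (l : ℝ) (B : Finset (Finset (Fin k → Fin n))) :
    ℕ → Finset (Finset (Fin k → Fin n) × Finset (Fin k))
  | 0 => {(Finset.univ, ∅)}
  | r + 1 => (restrictions B (states l B r)).image fun s => (s.1 \ heavyPart l s.1 s.2, s.2)

/-- A large state, at least half of which violates spreadness. -/
structure IsCritical (l : ℝ) (H : ℕ) (Y : Finset (Fin k → Fin n)) (I : Finset (Fin k)) : Prop where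
  nonempty : Y.Nonempty
  constantOn : ConstantOn Y I
  isSpread : IsSpread l 4 Y I
  large : (n : ℝ) ^ k ≤ 4 ^ H * (l ^ I.card * Y.card)
  card_le : Y.card ≤ 2 * (heavyPart l Y I).card

/-- The graph contains an extension of the fixed vertices whenever the adversary needs one. -/
def IsGood (l : ℝ) (H : ℕ) (B : Finset (Finset (Fin k → Fin n)))
    (G : SimpleGraph (Fin k × Fin n)) : Prop :=
  ∀ r < H, ∀ s ∈ restrictions B (states l B r), IsCritical l H s.1 s.2 →
    ∃ x ∈ s.1, ∃ J, IsHeavy l s.1 s.2 J x ∧ ∀ e ∈ extensionEdges s.2 J x, e ∈ G.edgeSet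

/-- All elements of `Y` choose the same pair of non-adjacent vertices. -/
def ContainsNonEdge (G : SimpleGraph (Fin k × Fin n)) (Y : Finset (Fin k → Fin n)) : Prop :=
  Y = ∅ ∨ ∃ i j a b, i ≠ j ∧ ¬ G.Adj (i, a) (j, b) ∧ ∀ x ∈ Y, x i = a ∧ x j = b

/-- The invariant of the adversary after `r` queries. -/
structure IsConsistent (l : ℝ) (r : ℕ) (G : SimpleGraph (Fin k × Fin n))
    (Y : Finset (Fin k → Fin n)) (I : Finset (Fin k)) : Prop where
  nonempty : Y.Nonempty
  constantOn : ConstantOn Y I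
  isSpread : IsSpread l 2 Y I
  large : (n : ℝ) ^ k ≤ 4 ^ r * (l ^ I.card * Y.card)
  isCliqueOn : ∀ x ∈ Y, IsCliqueOn G I x

/-- A block on which all of `Y` agrees must be in `I`, since otherwise fixing it would not shrink
`Y`, against spreadness with `l > 2`. A common non-edge would thus lie in the clique on `I`. -/
theorem IsConsistent.not_containsNonEdge {l : ℝ} (hl : 2 < l) {r : ℕ}
    {G : SimpleGraph (Fin k × Fin n)} {Y : Finset (Fin k → Fin n)} {I : Finset (Fin k)}
    (hY : IsConsistent l r G Y I) {X : Finset (Fin k → Fin n)} (hX : Y ⊆ X) :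
    ¬ ContainsNonEdge G X := by
  obtain ⟨x, hx⟩ := hY.nonempty
  rintro (rfl | ⟨i, j, a, b, hij, hG, hab⟩)
  · simpa using hX hx
  have hmem : ∀ i a, (∀ x ∈ Y, x i = a) → i ∈ I := by
    intro i a h
    by_contra hi
    have hfib : fiber Y (insert i I) x = Y := by
      refine Finset.filter_true_of_mem fun y hy j hj => ?_
      rcases Finset.mem_insert.1 hj with rfl | hj
      · rw [h y hy, h x hx]
      · exact hY.constantOn x hx y hy j hj
    have hs := hY.isSpread x hx (insert i I) (Finset.subset_insert i I)
    rw [hfib, Finset.card_insert_of_notMem hi, pow_succ] at hs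
    have hpos : 0 < l ^ I.card * (Y.card : ℝ) :=
      mul_pos (pow_pos (by linarith) _) (Nat.cast_pos.2 (Finset.card_pos.2 ⟨x, hx⟩))
    nlinarith
  have hi := hmem i a fun x hx => (hab x (hX hx)).1
  have hj := hmem j b fun x hx => (hab x (hX hx)).2
  have hadj := hY.isCliqueOn x hx i hi j hj hij
  rw [(hab x (hX hx)).1, (hab x (hX hx)).2] at hadj
  exact hG hadj

/-- One round of the adversary: after a query that at most halves the state, it can fix blocks so as
to get into a consistent state again. -/
theorem IsConsistent.exists_restriction {l : ℝ} (hl : 0 < l) {r H : ℕ} (hr : r < H)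
    {G : SimpleGraph (Fin k × Fin n)} {B : Finset (Finset (Fin k → Fin n))} (hG : IsGood l H B G)
    {Y : Finset (Fin k → Fin n)} {I : Finset (Fin k)} (hY : IsConsistent l r G Y I)
    {Y' : Finset (Fin k → Fin n)} (hsub : Y' ⊆ Y) (hhalf : Y.card ≤ 2 * Y'.card)
    (hres : ∀ J x, (fiber Y' J x, J) ∈ restrictions B (states l B r)) :
    ∃ Y'' ⊆ Y', ∃ J, (Y'', J) ∈ states l B (r + 1) ∧ IsConsistent l (r + 1) G Y'' J := by
  classical
  have hhalf' : (Y.card : ℝ) ≤ 2 * Y'.card := by exact_mod_cast hhalf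
  have hY'ne : Y'.Nonempty := by
    rw [← Finset.card_pos]
    have := Finset.card_pos.2 hY.nonempty
    omega
  -- Halving the set doubles the spreadness constant from 2 to 4.
  have hspread : ∀ x ∈ Y', ∀ J, I ⊆ J →
      l ^ J.card * (fiber Y' J x).card ≤ 4 * (l ^ I.card * Y'.card) := by
    intro x hx J hIJ
    have h1 := hY.isSpread x (hsub hx) J hIJ
    have h2 : ((fiber Y' J x).card : ℝ) ≤ (fiber Y J x).card := by
      exact_mod_cast Finset.card_le_card (fiber_mono hsub J x)
    have h3 := mul_le_mul_of_nonneg_left h2 (pow_pos hl J.card).le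
    have h4 := mul_le_mul_of_nonneg_left hhalf' (pow_pos hl I.card).le
    linarith
  set P := (Finset.univ : Finset (Finset (Fin k) × (Fin k → Fin n))).filter fun t =>
    I ⊆ t.1 ∧ t.2 ∈ Y' ∧ IsCliqueOn G t.1 t.2 with hPdef
  obtain ⟨x₀, hx₀⟩ := hY'ne
  have hP₀ : (I, x₀) ∈ P := Finset.mem_filter.2
    ⟨Finset.mem_univ _, subset_rfl, hx₀, hY.isCliqueOn x₀ (hsub hx₀)⟩
  -- Maximality of the potential serves three ends: the potential does not drop below that of `Y'`,
  -- the fiber inherits spreadness with constant 4, and no heavy extension of it can be a clique.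
  obtain ⟨⟨J, x⟩, hJx, hmax⟩ := Finset.exists_max_image P
    (fun t => l ^ t.1.card * ((fiber Y' t.1 t.2).card : ℝ)) ⟨_, hP₀⟩
  obtain ⟨-, hIJ, hx, hclique⟩ := Finset.mem_filter.1 hJx
  dsimp only at hIJ hx hclique hmax
  set Z := fiber Y' J x with hZ
  have hxZ : x ∈ Z := mem_fiber.2 ⟨hx, fun _ _ => rfl⟩
  have hZY : Z ⊆ Y' := fiber_subset Y' J x
  have hconst : ConstantOn Z J := fun y hy z hz j hj =>
    ((mem_fiber.1 hz).2 j hj).trans ((mem_fiber.1 hy).2 j hj).symm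
  have hΦ : l ^ I.card * (Y'.card : ℝ) ≤ l ^ J.card * (Z.card : ℝ) := by
    have h := hmax _ hP₀
    have hfib : fiber Y' I x₀ = Y' :=
      ConstantOn.fiber_eq (fun y hy z hz => hY.constantOn y (hsub hy) z (hsub hz)) hx₀
    rwa [hfib] at h
  have hlarge : (n : ℝ) ^ k ≤ 4 ^ r * (2 * (l ^ J.card * Z.card)) := by
    refine hY.large.trans (mul_le_mul_of_nonneg_left ?_ (by positivity))
    have h4 := mul_le_mul_of_nonneg_left hhalf' (pow_pos hl I.card).le
    linarith
  have hZpos : 0 ≤ l ^ J.card * (Z.card : ℝ) := mul_nonneg (pow_pos hl _).le (Nat.cast_nonneg _)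
  -- Otherwise the state is critical, and goodness yields a heavy extension whose new edges are in
  -- `G`: a clique on more blocks with larger potential.
  have hheavy : 2 * (heavyPart l Z J).card < Z.card := by
    by_contra! hle
    obtain ⟨y, hy, J', hJ', hedges⟩ := hG r hr _ (hres J x) {
      nonempty := ⟨x, hxZ⟩
      constantOn := hconst
      isSpread := by
        intro y hy J' hJ'
        rw [fiber_fiber hJ' hy]
        refine (hspread y (hZY hy) J' (hIJ.trans hJ')).trans ?_
        exact mul_le_mul_of_nonneg_left hΦ (by norm_num)
      large := by
        refine hlarge.trans ?_
        have : (4 : ℝ) ^ (r + 1) ≤ 4 ^ H := pow_le_pow_right₀ (by norm_num) hr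
        rw [pow_succ] at this
        have hp : (0 : ℝ) ≤ 4 ^ r := by positivity
        nlinarith [mul_le_mul_of_nonneg_right this hZpos, mul_nonneg hp hZpos]
      card_le := hle }
    dsimp only at hy hJ' hedges
    have hcl : IsCliqueOn G J' y := by
      intro i hi j hj hij
      by_cases hI : i ∈ J ∧ j ∈ J
      · rw [(mem_fiber.1 hy).2 i hI.1, (mem_fiber.1 hy).2 j hI.2]
        exact hclique i hI.1 j hI.2 hij
      · refine (SimpleGraph.mem_edgeSet G).1 (hedges _ (Finset.mem_image.2 ⟨(i, j), ?_, rfl⟩))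
        exact Finset.mem_filter.2 ⟨Finset.mem_product.2 ⟨hi, hj⟩, hij, hI⟩
    have h := hmax (J', y) (Finset.mem_filter.2
      ⟨Finset.mem_univ _, hIJ.trans hJ'.1, hZY hy, hcl⟩)
    have h' := hJ'.2
    rw [fiber_fiber hJ'.1 hy] at h'
    exact absurd h (not_le.2 h')
  have hHZ : heavyPart l Z J ⊆ Z := fun y hy => (mem_heavyPart.1 hy).1
  have hcard : (Z.card : ℝ) ≤ 2 * (Z \ heavyPart l Z J).card := by
    have := Finset.card_sdiff_of_subset hHZ
    have h : Z.card ≤ 2 * (Z \ heavyPart l Z J).card := by omega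
    exact_mod_cast h
  have hcard' := mul_le_mul_of_nonneg_left hcard (pow_pos hl J.card).le
  have hsubZ : Z \ heavyPart l Z J ⊆ Z := Finset.sdiff_subset
  refine ⟨Z \ heavyPart l Z J, hsubZ.trans hZY, J,
    Finset.mem_image.2 ⟨(Z, J), hres J x, rfl⟩, ?_, ?_, ?_, ?_, ?_⟩
  · rw [← Finset.card_pos]
    have := Finset.card_sdiff_of_subset hHZ
    omega
  · exact fun y hy z hz => hconst y (hsubZ hy) z (hsubZ hz)
  · intro y hy J' hJ'
    rw [Finset.mem_sdiff, mem_heavyPart] at hy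
    -- The surviving elements satisfy the spreadness bound with factor 1 relative to `Z`; as at most
    -- half of `Z` was deleted, the factor is 2 relative to the new set.
    have h1 : l ^ J'.card * ((fiber Z J' y).card : ℝ) ≤ l ^ J.card * Z.card := by
      by_contra! h
      exact hy.2 ⟨hy.1, J', hJ', h⟩
    have h2 : ((fiber (Z \ heavyPart l Z J) J' y).card : ℝ) ≤ (fiber Z J' y).card := by
      exact_mod_cast Finset.card_le_card (fiber_mono hsubZ J' y)
    have h3 := mul_le_mul_of_nonneg_left h2 (pow_pos hl J'.card).le
    linarith
  · refine hlarge.trans ?_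
    rw [pow_succ, mul_assoc]
    exact mul_le_mul_of_nonneg_left (by linarith) (by positivity)
  · intro y hy i hi j hj hij
    have hyZ := (mem_fiber.1 (hsubZ hy)).2
    rw [hyZ i hi, hyZ j hj]
    exact hclique i hi j hj hij

/-- The adversary follows the branch containing the larger part of `Y`, and its state stays inside
the set of elements arriving at the current node. -/
theorem IsConsistent.not_solves {l : ℝ} (hl : 2 < l) {H : ℕ}
    {G : SimpleGraph (Fin k × Fin n)} {B : Finset (Finset (Fin k → Fin n))} (hG : IsGood l H B G)
    (h : ℕ) {r : ℕ} (hr : r + h = H) {Y : Finset (Fin k → Fin n)} {I : Finset (Fin k)}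
    (hstate : (Y, I) ∈ states l B r) (hY : IsConsistent l r G Y I)
    {X : Finset (Fin k → Fin n)} (hX : Y ⊆ X) : ¬ Solves B (ContainsNonEdge G) h X := by
  induction h generalizing r Y I X with
  | zero => exact hY.not_containsNonEdge hl hX
  | succ h ih =>
    rintro ⟨Q, hQ, h1, h2⟩
    have hcard := Finset.card_inter_add_card_sdiff Y Q
    rcases le_total (Y \ Q).card (Y ∩ Q).card with hle | hle
    · obtain ⟨Y'', hsub, J, hs, hc⟩ := hY.exists_restriction (by linarith) (by omega) hG
        (Finset.inter_subset_left (s₂ := Q)) (by omega) fun J x =>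
          Finset.mem_image.2 ⟨(((Y, I), Q), (true, J, x)), by simp [hstate, hQ], by simp⟩
      exact ih (by omega) hs hc
        (hsub.trans (Finset.inter_subset_inter hX subset_rfl)) h1
    · obtain ⟨Y'', hsub, J, hs, hc⟩ := hY.exists_restriction (by linarith) (by omega) hG
        (Finset.sdiff_subset (t := Q)) (by omega) fun J x =>
          Finset.mem_image.2 ⟨(((Y, I), Q), (false, J, x)), by simp [hstate, hQ], by simp⟩
      exact ih (by omega) hs hc
        (hsub.trans (Finset.sdiff_subset_sdiff hX subset_rfl)) h2

theorem card_fiber_mul_le (Y : Finset (Fin k → Fin n)) (J : Finset (Fin k)) (x : Fin k → Fin n) :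
    (fiber Y J x).card * n ^ J.card ≤ n ^ k := by
  have hsub : fiber Y J x ⊆
      Fintype.piFinset fun i => if i ∈ J then {x i} else (Finset.univ : Finset (Fin n)) := by
    intro y hy
    rw [Fintype.mem_piFinset]
    intro i
    split_ifs with hi
    · exact Finset.mem_singleton.2 ((mem_fiber.1 hy).2 i hi)
    · exact Finset.mem_univ _
  refine (Nat.mul_le_mul_right _ (Finset.card_le_card hsub)).trans (le_of_eq ?_)
  rw [Fintype.card_piFinset]
  have : ∀ i, (if i ∈ J then {x i} else (Finset.univ : Finset (Fin n))).card =
      if i ∈ J then 1 else n := by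
    intro i
    split_ifs <;> simp
  simp only [this]
  rw [Finset.prod_ite, Finset.prod_const_one, one_mul, Finset.prod_const, ← pow_add]
  congr 1
  have h1 : (Finset.univ.filter fun i => i ∉ J).card = k - J.card := by
    rw [Finset.filter_notMem_eq_sdiff, ← Finset.compl_eq_univ_sdiff, Finset.card_compl,
      Fintype.card_fin]
  have h2 : J.card ≤ k := (Finset.card_le_univ J).trans (Fintype.card_fin k).le
  omega

/-- The adversary wins: the search problem of a good graph has no shallow decision tree. -/
theorem IsGood.not_solves {l : ℝ} (hl : 2 < l) (hln : l ≤ n) {H : ℕ}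
    {G : SimpleGraph (Fin k × Fin n)} {B : Finset (Finset (Fin k → Fin n))}
    (hG : IsGood l H B G) : ¬ Solves B (ContainsNonEdge G) H Finset.univ := by
  have hn : 0 < n := by
    have : (0 : ℝ) < n := by linarith
    exact_mod_cast this
  have : Nonempty (Fin n) := ⟨⟨0, hn⟩⟩
  refine IsConsistent.not_solves hl hG H (r := 0) (zero_add H) (Y := Finset.univ) (I := ∅)
    (Finset.mem_singleton_self _) ⟨Finset.univ_nonempty, ?_, ?_, ?_, ?_⟩ subset_rfl
  · intro x _ y _ i hi
    simp at hi
  · intro x _ J _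
    have h1 := card_fiber_mul_le Finset.univ J x
    have h2 : ((fiber Finset.univ J x).card : ℝ) * (n : ℝ) ^ J.card ≤ (n : ℝ) ^ k := by
      exact_mod_cast h1
    have h3 : l ^ J.card ≤ (n : ℝ) ^ J.card := pow_le_pow_left₀ (by linarith) hln _
    have h4 := mul_le_mul_of_nonneg_left h3 (Nat.cast_nonneg (α := ℝ) (fiber Finset.univ J x).card)
    have h5 : (0 : ℝ) ≤ (n : ℝ) ^ k := by positivity
    simp only [Finset.card_empty, pow_zero, one_mul, Finset.card_univ, Fintype.card_pi,
      Fintype.card_fin, Finset.prod_const]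
    push_cast
    linarith
  · simp
  · intro x _ i hi
    simp at hi

theorem card_restrictions_le (B : Finset (Finset (Fin k → Fin n)))
    (F : Finset (Finset (Fin k → Fin n) × Finset (Fin k))) :
    (restrictions B F).card ≤ F.card * (B.card * (2 * (2 ^ k * n ^ k))) := by
  refine Finset.card_image_le.trans (le_of_eq ?_)
  simp [Finset.card_product, mul_assoc]

theorem card_states_le (l : ℝ) (B : Finset (Finset (Fin k → Fin n))) (r : ℕ) :
    (states l B r).card ≤ (B.card * (2 * (2 ^ k * n ^ k))) ^ r := by
  induction r with
  | zero => simp [states]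
  | succ r ih =>
    rw [pow_succ]
    exact Finset.card_image_le.trans ((card_restrictions_le B _).trans
      (Nat.mul_le_mul_right _ ih))

end CliqueTh

/-! ### Random graphs satisfy the extension property -/

namespace CliqueTh

variable {k n : ℕ}

theorem mem_extensionEdges {I J : Finset (Fin k)} {x : Fin k → Fin n}
    {e : Sym2 (Fin k × Fin n)} : e ∈ extensionEdges I J x ↔
      ∃ i ∈ J, ∃ j ∈ J, i ≠ j ∧ ¬ (i ∈ I ∧ j ∈ I) ∧ s((i, x i), (j, x j)) = e := by
  simp only [extensionEdges, Finset.mem_image, Finset.mem_filter, Finset.mem_product, Prod.exists]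
  constructor
  · rintro ⟨i, j, ⟨⟨hi, hj⟩, hij, h⟩, rfl⟩
    exact ⟨i, hi, j, hj, hij, h, rfl⟩
  · rintro ⟨i, hi, j, hj, hij, h, rfl⟩
    exact ⟨i, j, ⟨⟨hi, hj⟩, hij, h⟩, rfl⟩

/-- The probability of a pair of vertices to be an edge of a binomial random graph. -/
noncomputable def pairProb (k n : ℕ) (p : ℝ) (e : Sym2 (Fin k × Fin n)) : ℝ :=
  if e.IsDiag then 0 else p

theorem pairProb_mem {p : ℝ} (h0 : 0 ≤ p) (h1 : p ≤ 1) (e : Sym2 (Fin k × Fin n)) :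
    0 ≤ pairProb k n p e ∧ pairProb k n p e ≤ 1 := by
  unfold pairProb
  split_ifs
  · exact ⟨le_rfl, zero_le_one⟩
  · exact ⟨h0, h1⟩

theorem not_isDiag_of_mem_extensionEdges {I J : Finset (Fin k)} {x : Fin k → Fin n}
    {e : Sym2 (Fin k × Fin n)} (he : e ∈ extensionEdges I J x) : ¬ e.IsDiag := by
  obtain ⟨i, -, j, -, hij, -, rfl⟩ := mem_extensionEdges.1 he
  rw [Sym2.mk_isDiag_iff]
  exact fun h => hij (congrArg Prod.fst h)

theorem prod_pairProb {p : ℝ} {S : Finset (Sym2 (Fin k × Fin n))} (hS : ∀ e ∈ S, ¬ e.IsDiag) :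
    ∏ e ∈ S, pairProb k n p e = p ^ S.card := by
  rw [← Finset.prod_const]
  exact Finset.prod_congr rfl fun e he => if_neg (hS e he)

theorem card_extensionEdges_le (I J : Finset (Fin k)) (x : Fin k → Fin n) :
    (extensionEdges I J x).card ≤ k ^ 2 := by
  have hJ : J.card ≤ k := (Finset.card_le_univ J).trans (Fintype.card_fin k).le
  refine Finset.card_image_le.trans ((Finset.card_filter_le _ _).trans ?_)
  rw [Finset.card_product, sq]
  exact Nat.mul_le_mul hJ hJ

/-- The blocks of `J` outside of `I` on which `x` and `y` agree. -/
def agreement (I J : Finset (Fin k)) (x y : Fin k → Fin n) : Finset (Fin k) :=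
  (J \ I).filter fun i => y i = x i

/-- Every shared edge has an endpoint outside `I`, where `x` and `y` must agree; its other endpoint
is determined by a block of `J`. -/
theorem card_inter_extensionEdges_le (I J J' : Finset (Fin k)) (x y : Fin k → Fin n) :
    (extensionEdges I J x ∩ extensionEdges I J' y).card ≤ (agreement I J x y).card * J.card := by
  have hsub : extensionEdges I J x ∩ extensionEdges I J' y ⊆
      (agreement I J x y ×ˢ J).image fun t => s((t.1, x t.1), (t.2, x t.2)) := by
    intro e he
    obtain ⟨h1, h2⟩ := Finset.mem_inter.1 he
    obtain ⟨i', -, j', -, -, -, h⟩ := mem_extensionEdges.1 h2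
    have hagree : ∀ i, (i, x i) ∈ e → y i = x i := by
      intro i hi
      rw [← h, Sym2.mem_iff] at hi
      rcases hi with hi | hi
      · obtain ⟨rfl, h'⟩ := Prod.mk.inj hi
        exact h'.symm
      · obtain ⟨rfl, h'⟩ := Prod.mk.inj hi
        exact h'.symm
    obtain ⟨i, hi, j, hj, -, hI, rfl⟩ := mem_extensionEdges.1 h1
    rw [Finset.mem_image]
    by_cases hiI : i ∈ I
    · have hjI : j ∉ I := fun h => hI ⟨hiI, h⟩
      refine ⟨(j, i), Finset.mem_product.2 ⟨?_, hi⟩, Sym2.eq_swap⟩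
      exact Finset.mem_filter.2 ⟨Finset.mem_sdiff.2 ⟨hj, hjI⟩, hagree j (Sym2.mem_mk_right _ _)⟩
    · refine ⟨(i, j), Finset.mem_product.2 ⟨?_, hj⟩, rfl⟩
      exact Finset.mem_filter.2 ⟨Finset.mem_sdiff.2 ⟨hi, hiI⟩, hagree i (Sym2.mem_mk_left _ _)⟩
  refine (Finset.card_le_card hsub).trans (Finset.card_image_le.trans ?_)
  rw [Finset.card_product]

theorem one_add_pow_sub_one_le {t : ℝ} (ht : 0 ≤ t) (m : ℕ) (h : m * t ≤ 1) :
    (1 + t) ^ m - 1 ≤ 2 * (m * t) := by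
  have h0 : 0 ≤ m * t := by positivity
  have h1 : (1 + t) ^ m ≤ Real.exp (m * t) := by
    rw [Real.exp_nat_mul]
    refine pow_le_pow_left₀ (by linarith) ?_ m
    linarith [Real.add_one_le_exp t]
  have h2 := (abs_le.1 (Real.abs_exp_sub_one_le (x := m * t) (by rwa [abs_of_nonneg h0]))).2
  rw [abs_of_nonneg h0] at h2
  linarith

/-- A generating function for the agreement of the elements of a spread set with one of them. -/
theorem IsSpread.sum_agreement_le {l q : ℝ} (hl : 0 < l) (hq : 1 ≤ q) (hkq : k * q ≤ l)
    {Y : Finset (Fin k → Fin n)} {I : Finset (Fin k)} (hY : IsSpread l 4 Y I)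
    (hconst : ConstantOn Y I) {x : Fin k → Fin n} (hx : x ∈ Y) (J : Finset (Fin k)) :
    ∑ y ∈ Y, (if (agreement I J x y).Nonempty then q ^ (agreement I J x y).card else 0) ≤
      8 * k * q / l * Y.card := by
  classical
  -- The power of `q` is bounded by its sum over all nonempty sets `A` of agreeing blocks. By
  -- spreadness at most 4|Y| l^(-|A|) elements agree on `A`, so the total is governed by (1 + q/l)^k
  -- - 1.
  have h1 : ∀ y ∈ Y, (if (agreement I J x y).Nonempty then q ^ (agreement I J x y).card else 0) ≤
      ∑ A ∈ (J \ I).powerset.erase ∅, if A ⊆ agreement I J x y then q ^ A.card else 0 := by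
    intro y _
    have hnn : ∀ A ∈ (J \ I).powerset.erase ∅,
        0 ≤ if A ⊆ agreement I J x y then q ^ A.card else (0 : ℝ) := by
      intro A _
      split_ifs <;> positivity
    split_ifs with hne
    · refine le_trans (le_of_eq ?_) (Finset.single_le_sum hnn
        (show agreement I J x y ∈ _ from Finset.mem_erase.2 ⟨hne.ne_empty, Finset.mem_powerset.2
          (Finset.filter_subset _ _)⟩))
      simp
    · exact Finset.sum_nonneg hnn
  refine (Finset.sum_le_sum h1).trans ?_
  rw [Finset.sum_comm]
  have h2 : ∀ A ∈ (J \ I).powerset.erase ∅,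
      ∑ y ∈ Y, (if A ⊆ agreement I J x y then q ^ A.card else 0) ≤
        4 * Y.card * (q / l) ^ A.card := by
    intro A hA
    have hAJ := Finset.mem_powerset.1 (Finset.mem_of_mem_erase hA)
    rw [← Finset.sum_filter, Finset.sum_const, nsmul_eq_mul]
    have hsub : (Y.filter fun y => A ⊆ agreement I J x y) ⊆ fiber Y (I ∪ A) x := by
      intro y hy
      rw [Finset.mem_filter] at hy
      refine mem_fiber.2 ⟨hy.1, fun j hj => ?_⟩
      rcases Finset.mem_union.1 hj with hj | hj
      · exact hconst x hx y hy.1 j hj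
      · exact (Finset.mem_filter.1 (hy.2 hj)).2
    have hcard : (((Y.filter fun y => A ⊆ agreement I J x y).card : ℕ) : ℝ) ≤
        (fiber Y (I ∪ A) x).card := by exact_mod_cast Finset.card_le_card hsub
    have hsp := hY x hx (I ∪ A) Finset.subset_union_left
    have hdisj : Disjoint I A := Finset.disjoint_left.2 fun i hi hiA =>
      (Finset.mem_sdiff.1 (hAJ hiA)).2 hi
    rw [Finset.card_union_of_disjoint hdisj, pow_add, mul_assoc, mul_left_comm 4] at hsp
    have hsp' := le_of_mul_le_mul_left hsp (pow_pos hl _)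
    rw [div_pow, mul_div_assoc', le_div_iff₀ (pow_pos hl _)]
    calc _ ≤ ((fiber Y (I ∪ A) x).card : ℝ) * q ^ A.card * l ^ A.card := by gcongr
      _ = (l ^ A.card * (fiber Y (I ∪ A) x).card) * q ^ A.card := by ring
      _ ≤ _ := mul_le_mul_of_nonneg_right hsp' (by positivity)
  refine (Finset.sum_le_sum h2).trans ?_
  rw [← Finset.mul_sum]
  have h3 : ∑ A ∈ (J \ I).powerset.erase ∅, (q / l) ^ A.card = (1 + q / l) ^ (J \ I).card - 1 := by
    have h := Finset.sum_pow_mul_eq_add_pow (q / l) 1 (J \ I)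
    simp only [one_pow, mul_one] at h
    rw [add_comm, ← h, ← Finset.add_sum_erase _ _ (Finset.empty_mem_powerset (J \ I))]
    simp
  have ht : 0 ≤ q / l := by positivity
  have h4 : (1 + q / l) ^ (J \ I).card ≤ (1 + q / l) ^ k :=
    pow_le_pow_right₀ (by linarith) ((Finset.card_le_univ _).trans (Fintype.card_fin k).le)
  have h5 := one_add_pow_sub_one_le ht k (by rw [← mul_div_assoc]; exact (div_le_one hl).2 hkq)
  have h6 : ∑ A ∈ (J \ I).powerset.erase ∅, (q / l) ^ A.card ≤ 2 * (k * (q / l)) := by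
    rw [h3]; linarith
  refine (mul_le_mul_of_nonneg_left h6 (by positivity)).trans (le_of_eq ?_)
  ring

/-- A fiber over `J` has at most n^(k-|J|) elements, while heaviness keeps the potential large. This
bounds the number of blocks of a heavy extension, and thereby the loss p^(-|J|) per agreement. -/
theorem IsHeavy.pow_card_le {l : ℝ} (hl : 0 < l) {H : ℕ} {Y : Finset (Fin k → Fin n)}
    {I J : Finset (Fin k)} {x : Fin k → Fin n} (hJ : IsHeavy l Y I J x)
    (hn : 0 < n) (hY : (n : ℝ) ^ k ≤ 4 ^ H * (l ^ I.card * Y.card)) :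
    (n : ℝ) ^ J.card ≤ 4 ^ H * l ^ J.card := by
  have h1 : ((fiber Y J x).card : ℝ) * (n : ℝ) ^ J.card ≤ (n : ℝ) ^ k := by
    exact_mod_cast card_fiber_mul_le Y J x
  have h2 : (n : ℝ) ^ k ≤ 4 ^ H * (l ^ J.card * (fiber Y J x).card) :=
    hY.trans (mul_le_mul_of_nonneg_left hJ.2.le (by positivity))
  have hnk : (0 : ℝ) < (n : ℝ) ^ k := by positivity
  refine le_of_mul_le_mul_left ?_ hnk
  calc (n : ℝ) ^ k * (n : ℝ) ^ J.card ≤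
        4 ^ H * (l ^ J.card * (fiber Y J x).card) * (n : ℝ) ^ J.card := by gcongr
    _ = 4 ^ H * l ^ J.card * ((fiber Y J x).card * (n : ℝ) ^ J.card) := by ring
    _ ≤ 4 ^ H * l ^ J.card * (n : ℝ) ^ k := by gcongr
    _ = _ := by ring

/-- In a critical state the random graph almost surely contains the required extension. -/
theorem IsCritical.prob_le {l p q : ℝ} (hl : 0 < l) (hn : 0 < n) (hk : 0 < k) (hp0 : 0 < p)
    (hp1 : p ≤ 1) (hq : 1 ≤ q) (hkq : k * q ≤ l) {H : ℕ}
    (hpq : ∀ j : ℕ, (n : ℝ) ^ j ≤ 4 ^ H * l ^ j → 1 ≤ q * p ^ j)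
    {Y : Finset (Fin k → Fin n)} {I : Finset (Fin k)} (hY : IsCritical l H Y I) :
    RandomSubset.prob (pairProb k n p)
      (fun R => ∀ x ∈ Y, ∀ J, IsHeavy l Y I J x → ¬ extensionEdges I J x ⊆ R) ≤
      Real.exp (1 / 2 - 1 / (2 * (16 * k * (k ^ 2 + 1) * q / l))) := by
  classical
  have hpp := fun e => pairProb_mem (k := k) (n := n) hp0.le hp1 e
  have hJex : ∀ x ∈ heavyPart l Y I, ∃ J, IsHeavy l Y I J x := fun x hx => (mem_heavyPart.1 hx).2
  choose! J hJ using hJex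
  set S : (Fin k → Fin n) → Finset (Sym2 (Fin k × Fin n)) := fun x => extensionEdges I (J x) x
  -- Pigeonhole over the number of edges makes the sets equally likely, as the form of Janson's
  -- inequality requires, and costs a factor k² + 1.
  obtain ⟨m, -, hm⟩ := Finset.exists_le_card_fiber_of_nsmul_le_card_of_maps_to
    (s := heavyPart l Y I) (t := Finset.range (k ^ 2 + 1)) (f := fun x => (S x).card)
    (b := ((heavyPart l Y I).card : ℝ) / (k ^ 2 + 1))
    (fun x _ => Finset.mem_range.2 (Nat.lt_succ_of_le (card_extensionEdges_le I (J x) x)))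
    ⟨0, by simp⟩ (by
      rw [Finset.card_range, nsmul_eq_mul]
      push_cast
      rw [mul_div_cancel₀]
      positivity)
  set Z := (heavyPart l Y I).filter fun x => (S x).card = m with hZdef
  have hZY : ∀ x ∈ Z, x ∈ Y := fun x hx => (mem_heavyPart.1 (Finset.mem_filter.1 hx).1).1
  have hYZ : (Y.card : ℝ) ≤ 2 * (k ^ 2 + 1) * Z.card := by
    have h1 : (Y.card : ℝ) ≤ 2 * (heavyPart l Y I).card := by exact_mod_cast hY.card_le
    rw [div_le_iff₀ (by positivity)] at hm
    linarith
  have hYpos : (0 : ℝ) < Y.card := Nat.cast_pos.2 (Finset.card_pos.2 hY.nonempty)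
  have hZne : Z.Nonempty := by
    rw [← Finset.card_pos]
    by_contra! h
    have : (Z.card : ℝ) = 0 := by exact_mod_cast Nat.le_zero.1 h
    rw [this, mul_zero] at hYZ
    linarith
  have hmono : RandomSubset.prob (pairProb k n p)
      (fun R => ∀ x ∈ Y, ∀ J, IsHeavy l Y I J x → ¬ extensionEdges I J x ⊆ R) ≤
      RandomSubset.prob (pairProb k n p) (fun R => ∀ x ∈ Z, ¬ S x ⊆ R) :=
    RandomSubset.prob_mono hpp fun R h x hx => h x (hZY x hx) _ (hJ x (Finset.mem_filter.1 hx).1)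
  refine hmono.trans (RandomSubset.prob_none_le_exp hpp Z hZne S (P := p ^ m) (pow_pos hp0 m)
    (by positivity) ?_ ?_)
  · intro x hx
    rw [prod_pairProb fun e he => not_isDiag_of_mem_extensionEdges he,
      (Finset.mem_filter.1 hx).2]
  · intro x hx
    have hterm : ∀ y ∈ Z, (if Disjoint (S x) (S y) then 0 else
        ∏ e ∈ S x ∪ S y, pairProb k n p e) ≤ (p ^ m) ^ 2 *
        (if (agreement I (J x) x y).Nonempty then q ^ (agreement I (J x) x y).card else 0) := by
      intro y hy
      split_ifs with hd hne hne
      · positivity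
      · simp
      · rw [prod_pairProb fun e he => by
          rcases Finset.mem_union.1 he with h | h <;> exact not_isDiag_of_mem_extensionEdges h]
        have hcard := Finset.card_union_add_card_inter (S x) (S y)
        rw [(Finset.mem_filter.1 hx).2, (Finset.mem_filter.1 hy).2] at hcard
        have hinter := card_inter_extensionEdges_le I (J x) (J y) x y
        have hone := hpq (J x).card
          ((hJ x (Finset.mem_filter.1 hx).1).pow_card_le hl hn hY.large)
        set g := (agreement I (J x) x y).card
        -- The union has at least 2m - g|J| edges, and the factor `(q * p ^ |J|) ^ g ≥ 1` pays for
        -- the shared ones.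
        calc p ^ (S x ∪ S y).card ≤ p ^ (S x ∪ S y).card * (q * p ^ (J x).card) ^ g :=
              le_mul_of_one_le_right (by positivity) (one_le_pow₀ hone)
          _ = p ^ ((S x ∪ S y).card + (J x).card * g) * q ^ g := by
              rw [mul_pow, pow_add, pow_mul]; ring
          _ ≤ p ^ (m * 2) * q ^ g := by
              refine mul_le_mul_of_nonneg_right ?_ (by positivity)
              refine pow_le_pow_of_le_one hp0.le hp1 ?_
              have : (S x ∩ S y).card ≤ g * (J x).card := hinter
              rw [mul_comm g] at this
              omega
          _ = _ := by rw [pow_mul]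
      · exfalso
        rw [Finset.not_nonempty_iff_eq_empty] at hne
        have hinter := card_inter_extensionEdges_le I (J x) (J y) x y
        rw [hne, Finset.card_empty, zero_mul, Nat.le_zero, Finset.card_eq_zero] at hinter
        exact hd (Finset.disjoint_iff_inter_eq_empty.2 hinter)
    refine (Finset.sum_le_sum hterm).trans ?_
    rw [← Finset.mul_sum]
    have hsum := hY.isSpread.sum_agreement_le hl hq hkq hY.constantOn (hZY x hx) (J x)
    have hsub : ∑ y ∈ Z, (if (agreement I (J x) x y).Nonempty then
        q ^ (agreement I (J x) x y).card else 0) ≤ ∑ y ∈ Y,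
        (if (agreement I (J x) x y).Nonempty then q ^ (agreement I (J x) x y).card else 0) := by
      refine Finset.sum_le_sum_of_subset_of_nonneg hZY fun y _ _ => ?_
      split_ifs <;> positivity
    have hfin : 8 * k * q / l * (Y.card : ℝ) ≤ 16 * k * (k ^ 2 + 1) * q / l * Z.card := by
      refine (mul_le_mul_of_nonneg_left hYZ (by positivity)).trans (le_of_eq ?_)
      ring
    refine (mul_le_mul_of_nonneg_left ((hsub.trans hsum).trans hfin) (by positivity)).trans
      (le_of_eq ?_)
    ring

end CliqueTh

/-! ### From random sets of pairs to random graphs -/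

namespace CliqueTh

open MeasureTheory

theorem measurableSingletonClass_simpleGraph (V : Type) [Countable V] :
    MeasurableSingletonClass (SimpleGraph V) := by
  refine ⟨fun G => ?_⟩
  have h : ({G} : Set (SimpleGraph V)) = SimpleGraph.edgeSet ⁻¹' {G.edgeSet} := by
    ext G'
    simp
  rw [h]
  exact SimpleGraph.measurable_edgeSet (measurableSet_singleton _)

variable {k n : ℕ}

-- `pairProb` vanishes on the diagonal, so loops contribute factors 1 and the product over all of
-- `Sym2` reduces to the binomial weight.
open Classical in
theorem weight_edgeFinset (p : ℝ) (G : SimpleGraph (Fin k × Fin n)) :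
    RandomSubset.weight (pairProb k n p) G.edgeFinset =
      p ^ G.edgeSet.ncard * (1 - p) ^ ((Nat.card (Fin k × Fin n)).choose 2 - G.edgeSet.ncard) := by
  have hcard : G.edgeSet.ncard = G.edgeFinset.card := by
    rw [← SimpleGraph.coe_edgeFinset, Set.ncard_coe_finset]
  rw [RandomSubset.weight, Finset.prod_ite]
  congr 1
  · rw [hcard, prod_pairProb]
    · congr 2
      ext e
      simp
    · intro e he
      exact G.not_isDiag_of_mem_edgeFinset (Finset.mem_filter.1 he).2
  · have h1 : ∀ e : Sym2 (Fin k × Fin n), 1 - pairProb k n p e = if e.IsDiag then 1 else 1 - p := by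
      intro e
      unfold pairProb
      split_ifs <;> simp
    simp only [h1]
    rw [Finset.prod_ite, Finset.prod_const_one, one_mul, Finset.prod_const, Finset.filter_filter]
    congr 1
    have hall : (Finset.univ.filter fun e : Sym2 (Fin k × Fin n) => ¬ e.IsDiag).card =
        (Nat.card (Fin k × Fin n)).choose 2 := by
      rw [Nat.card_eq_fintype_card, ← Sym2.card_subtype_not_diag, Fintype.card_subtype]
    rw [hcard, ← hall, ← Finset.card_sdiff_of_subset]
    · congr 1
      ext e
      simp only [Finset.mem_filter, Finset.mem_univ, true_and, Finset.mem_sdiff]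
      tauto
    · intro e he
      exact Finset.mem_filter.2 ⟨Finset.mem_univ _, G.not_isDiag_of_mem_edgeFinset he⟩

open Classical in
theorem binomialRandom_le_prob (p : unitInterval) (T : Set (SimpleGraph (Fin k × Fin n)))
    (A : Finset (Sym2 (Fin k × Fin n)) → Prop) (hA : ∀ G ∈ T, A G.edgeFinset) :
    SimpleGraph.binomialRandom (Fin k × Fin n) p T ≤
      ENNReal.ofReal (RandomSubset.prob (pairProb k n p) A) := by
  have := measurableSingletonClass_simpleGraph (Fin k × Fin n)
  have hpp := fun e => pairProb_mem (k := k) (n := n) p.2.1 p.2.2 e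
  have h1 : (Set.toFinset T : Set (SimpleGraph (Fin k × Fin n))) = T := Set.coe_toFinset T
  rw [← h1, ← sum_measure_singleton]
  have h2 : ∀ G : SimpleGraph (Fin k × Fin n),
      SimpleGraph.binomialRandom (Fin k × Fin n) p {G} =
        ENNReal.ofReal (RandomSubset.weight (pairProb k n p) G.edgeFinset) := by
    intro G
    rw [SimpleGraph.binomialRandom_singleton, weight_edgeFinset,
      ENNReal.ofReal_mul (pow_nonneg p.2.1 _), ENNReal.ofReal_pow p.2.1,
      ENNReal.ofReal_pow (sub_nonneg.2 p.2.2)]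
    congr 2 <;> congr 1
    · exact (Real.toNNReal_of_nonneg p.2.1).symm
    · exact (Real.toNNReal_of_nonneg (sub_nonneg.2 p.2.2)).symm
  simp only [h2]
  rw [← ENNReal.ofReal_sum_of_nonneg fun G _ => RandomSubset.weight_nonneg hpp _]
  refine ENNReal.ofReal_le_ofReal ?_
  have hinj : Set.InjOn (fun G : SimpleGraph (Fin k × Fin n) => G.edgeFinset) (Set.toFinset T) :=
    fun G _ G' _ h => SimpleGraph.edgeFinset_inj.1 h
  rw [← Finset.sum_image (f := RandomSubset.weight (pairProb k n p)) hinj, RandomSubset.prob]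
  simp only [mul_ite, mul_one, mul_zero]
  rw [← Finset.sum_filter]
  refine Finset.sum_le_sum_of_subset_of_nonneg ?_ fun R _ _ => RandomSubset.weight_nonneg hpp R
  intro R hR
  obtain ⟨G, hG, rfl⟩ := Finset.mem_image.1 hR
  exact Finset.mem_filter.2 ⟨Finset.mem_univ _, hA G (Set.mem_toFinset.1 hG)⟩

open Classical in
theorem randomPartite_le_prob (p : unitInterval) (T : Set (SimpleGraph (Fin k × Fin n)))
    (A : Finset (Sym2 (Fin k × Fin n)) → Prop)
    (hA : ∀ G : SimpleGraph (Fin k × Fin n),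
      G ⊓ SimpleGraph.completeEquipartiteGraph k n ∈ T → A G.edgeFinset) :
    randomPartite n k p T ≤ ENNReal.ofReal (RandomSubset.prob (pairProb k n p) A) := by
  have := measurableSingletonClass_simpleGraph (Fin k × Fin n)
  rw [randomPartite, Measure.map_apply .of_discrete .of_discrete]
  exact binomialRandom_le_prob p _ A fun G hG => hA G hG

instance (p : unitInterval) : IsProbabilityMeasure (randomPartite n k p) := by
  have := measurableSingletonClass_simpleGraph (Fin k × Fin n)
  exact Measure.isProbabilityMeasure_map (Measurable.of_discrete).aemeasurable

theorem tendsto_randomPartite_one {k : ℕ → ℕ} {p : ℕ → unitInterval}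
    {T : ∀ n, Set (SimpleGraph (Fin (k n) × Fin n))}
    (h : Tendsto (fun n => randomPartite n (k n) (p n) (T n)ᶜ) atTop (𝓝 0)) :
    Tendsto (fun n => randomPartite n (k n) (p n) (T n)) atTop (𝓝 1) := by
  have h1 : ∀ n, randomPartite n (k n) (p n) (T n) = 1 - randomPartite n (k n) (p n) (T n)ᶜ := by
    intro n
    have := measurableSingletonClass_simpleGraph (Fin (k n) × Fin n)
    rw [prob_compl_eq_one_sub .of_discrete, ENNReal.sub_sub_cancel ENNReal.one_ne_top prob_le_one]
  simp only [h1]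
  simpa using ENNReal.Tendsto.sub tendsto_const_nhds h (Or.inl ENNReal.one_ne_top)

end CliqueTh

/-! ### Union bounds for the adversary states, for satisfiability and for short refutations -/

namespace RandomSubset

variable {E : Type*} [Fintype E] [DecidableEq E]

theorem prob_exists_le {p : E → ℝ} (hp : ∀ e, 0 ≤ p e ∧ p e ≤ 1) {ι : Type*} (s : Finset ι)
    (A : ι → Finset E → Prop) :
    prob p (fun R => ∃ i ∈ s, A i R) ≤ ∑ i ∈ s, prob p (A i) := by
  classical
  unfold prob
  rw [Finset.sum_comm]
  refine Finset.sum_le_sum fun R _ => ?_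
  rw [← Finset.mul_sum]
  refine mul_le_mul_of_nonneg_left ?_ (weight_nonneg hp R)
  have hnn : ∀ i ∈ s, (0 : ℝ) ≤ if A i R then 1 else 0 := fun i _ => by split_ifs <;> norm_num
  split_ifs with h
  · obtain ⟨i, hi, hA⟩ := h
    refine le_trans (le_of_eq ?_) (Finset.single_le_sum hnn hi)
    rw [if_pos hA]
  · exact Finset.sum_nonneg hnn

end RandomSubset

namespace CliqueTh

variable {k n : ℕ}

theorem mem_inf_edgeSet {I J : Finset (Fin k)} {x : Fin k → Fin n}
    {G : SimpleGraph (Fin k × Fin n)} {e : Sym2 (Fin k × Fin n)}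
    (he : e ∈ extensionEdges I J x) (hG : e ∈ G.edgeSet) :
    e ∈ (G ⊓ SimpleGraph.completeEquipartiteGraph k n).edgeSet := by
  obtain ⟨i, -, j, -, hij, -, rfl⟩ := mem_extensionEdges.1 he
  rw [SimpleGraph.mem_edgeSet] at hG ⊢
  exact ⟨hG, hij⟩

/-- Random graphs are good with high probability. -/
theorem randomPartite_not_isGood_le {l q : ℝ} {p : unitInterval} (hl : 0 < l) (hn : 0 < n)
    (hk : 0 < k) (hp0 : 0 < (p : ℝ)) (hq : 1 ≤ q) (hkq : k * q ≤ l) {H : ℕ}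
    (hpq : ∀ j : ℕ, (n : ℝ) ^ j ≤ 4 ^ H * l ^ j → 1 ≤ q * (p : ℝ) ^ j)
    {B : Finset (Finset (Fin k → Fin n))} (hB : B.Nonempty) :
    randomPartite n k p {G | ¬ IsGood l H B G} ≤
      ENNReal.ofReal (H * ((B.card * (2 * (2 ^ k * n ^ k)) : ℕ) : ℝ) ^ H *
        Real.exp (1 / 2 - 1 / (2 * (16 * k * (k ^ 2 + 1) * q / l)))) := by
  classical
  set W := B.card * (2 * (2 ^ k * n ^ k)) with hW
  set δ := Real.exp (1 / 2 - 1 / (2 * (16 * k * (k ^ 2 + 1) * q / l)))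
  have hpp := fun e => pairProb_mem (k := k) (n := n) p.2.1 p.2.2 e
  let A : (Finset (Fin k → Fin n) × Finset (Fin k)) → Finset (Sym2 (Fin k × Fin n)) → Prop :=
    fun s R => ∀ x ∈ s.1, ∀ J, IsHeavy l s.1 s.2 J x → ¬ extensionEdges s.2 J x ⊆ R
  -- The critical states do not depend on the graph, so a union bound over the rounds and over these
  -- states is legitimate.
  let F : ℕ → Finset (Finset (Fin k → Fin n) × Finset (Fin k)) := fun r =>
    (restrictions B (states l B r)).filter fun s => IsCritical l H s.1 s.2
  refine (randomPartite_le_prob p _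
    (fun R => ∃ r ∈ Finset.range H, ∃ s ∈ F r, A s R) ?_).trans (ENNReal.ofReal_le_ofReal ?_)
  · intro G hG
    simp only [Set.mem_ofPred_eq, IsGood] at hG
    push Not at hG
    obtain ⟨r, hr, s, hs, hcrit, h⟩ := hG
    refine ⟨r, Finset.mem_range.2 hr, s, Finset.mem_filter.2 ⟨hs, hcrit⟩, fun x hx J hJ hsub => ?_⟩
    obtain ⟨e, he, hne⟩ := h x hx J hJ
    exact hne (mem_inf_edgeSet he (SimpleGraph.mem_edgeFinset.1 (hsub he)))
  · have hW1 : 1 ≤ W := Nat.one_le_iff_ne_zero.2 (by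
      have := hB.card_pos
      positivity)
    have hF : ∀ r < H, (F r).card ≤ W ^ H := by
      intro r hr
      refine (Finset.card_filter_le _ _).trans ((card_restrictions_le B _).trans ?_)
      refine (Nat.mul_le_mul_right _ (card_states_le l B r)).trans ?_
      rw [← hW, ← pow_succ]
      exact Nat.pow_le_pow_right hW1 hr
    refine (RandomSubset.prob_exists_le hpp _ _).trans ?_
    calc _ ≤ ∑ r ∈ Finset.range H, ((W ^ H : ℕ) : ℝ) * δ := by
          refine Finset.sum_le_sum fun r hr => ?_
          refine (RandomSubset.prob_exists_le hpp _ _).trans ?_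
          refine (Finset.sum_le_card_nsmul _ _ δ fun s hs => ?_).trans ?_
          · exact IsCritical.prob_le hl hn hk hp0 p.2.2 hq hkq hpq (Finset.mem_filter.1 hs).2
          · rw [nsmul_eq_mul]
            exact mul_le_mul_of_nonneg_right
              (Nat.cast_le.2 (hF r (Finset.mem_range.1 hr))) (Real.exp_pos _).le
      _ = _ := by
          rw [Finset.sum_const, Finset.card_range, nsmul_eq_mul]
          push_cast
          ring

/-! ### The binary clique formula -/

/-- The Boolean encoding of a choice of one vertex in each block. -/
def encode (x : Fin k → Fin n) (v : BVar k n) : Bool :=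
  (x v.1).val.testBit v.2

theorem not_isSatisfiedBy_codeClause {i : Fin k} {a : ℕ} {α : BVar k n → Bool} :
    ¬ (codeClause i a : Clause (BVar k n)).IsSatisfiedBy α ↔
      ∀ b : Fin (Nat.clog 2 n), α (i, b) = a.testBit b := by
  simp [Clause.IsSatisfiedBy, codeClause]

theorem eq_of_not_isSatisfiedBy {i : Fin k} {a : ℕ} (ha : a < 2 ^ Nat.clog 2 n)
    {x : Fin k → Fin n}
    (h : ¬ (codeClause i a : Clause (BVar k n)).IsSatisfiedBy (encode x)) : (x i : ℕ) = a := by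
  rw [not_isSatisfiedBy_codeClause] at h
  refine Nat.eq_of_testBit_eq fun b => ?_
  rcases lt_or_ge b (Nat.clog 2 n) with hb | hb
  · exact h ⟨b, hb⟩
  · have hpow : 2 ^ Nat.clog 2 n ≤ 2 ^ b := Nat.pow_le_pow_right (by norm_num) hb
    have hx : (x i : ℕ) < 2 ^ b :=
      (x i).2.trans_le ((Nat.le_pow_clog (by norm_num) n).trans hpow)
    rw [Nat.testBit_lt_two_pow hx, Nat.testBit_lt_two_pow (ha.trans_le hpow)]

theorem not_isSatisfiedBy_union {V : Type} [DecidableEq V] {C C' : Clause V} {α : V → Bool}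
    (h : ¬ Clause.IsSatisfiedBy (C ∪ C') α) :
    ¬ C.IsSatisfiedBy α ∧ ¬ C'.IsSatisfiedBy α :=
  ⟨fun ⟨l, hl, hα⟩ => h ⟨l, Finset.mem_union_left _ hl, hα⟩,
    fun ⟨l, hl, hα⟩ => h ⟨l, Finset.mem_union_right _ hl, hα⟩⟩

theorem FalsifiesClause.containsNonEdge {G : SimpleGraph (Fin k × Fin n)}
    {Y : Finset (Fin k → Fin n)} (h : FalsifiesClause (binaryClique G) encode Y) :
    ContainsNonEdge G Y := by
  have hlt : ∀ a : Fin n, (a : ℕ) < 2 ^ Nat.clog 2 n := fun a =>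
    a.2.trans_le (Nat.le_pow_clog (by norm_num) n)
  rcases h with h | ⟨C, hC | hC, hY⟩
  · exact Or.inl h
  · obtain ⟨i, j, a, b, hij, hG, rfl⟩ := hC
    refine Or.inr ⟨i, j, a, b, hij, hG, fun x hx => ?_⟩
    have h := not_isSatisfiedBy_union (hY x hx)
    exact ⟨Fin.ext (eq_of_not_isSatisfiedBy (hlt a) h.1),
      Fin.ext (eq_of_not_isSatisfiedBy (hlt b) h.2)⟩
  · obtain ⟨i, a, hna, ha, rfl⟩ := hC
    refine Or.inl (Finset.eq_empty_of_forall_notMem fun x hx => ?_)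
    have := eq_of_not_isSatisfiedBy ha (hY x hx)
    have := (x i).2
    omega

/-- The block variables are read as binary numbers: the range axioms make them vertices, and the
edge axioms make these pairwise adjacent. -/
theorem exists_clique_of_satisfiable {G : SimpleGraph (Fin k × Fin n)}
    (h : (binaryClique G).Satisfiable) : ∃ x : Fin k → Fin n, IsCliqueOn G Finset.univ x := by
  obtain ⟨α, hα⟩ := h
  set a : Fin k → ℕ := fun i => Nat.ofBits fun b => α (i, b)
  have ha : ∀ i, ¬ (codeClause i (a i) : Clause (BVar k n)).IsSatisfiedBy α := by
    intro i
    rw [not_isSatisfiedBy_codeClause]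
    intro b
    simp [a, Nat.testBit_ofBits_lt]
  have hlt : ∀ i, a i < n := by
    intro i
    by_contra! hle
    exact ha i (hα _ (Or.inr ⟨i, a i, hle, Nat.ofBits_lt_two_pow _, rfl⟩))
  refine ⟨fun i => ⟨a i, hlt i⟩, fun i _ j _ hij => ?_⟩
  by_contra hG
  obtain ⟨l, hl, h⟩ := hα _ (Or.inl ⟨i, j, ⟨a i, hlt i⟩, ⟨a j, hlt j⟩, hij, hG, rfl⟩)
  rcases Finset.mem_union.1 hl with hl | hl
  · exact ha i ⟨l, hl, h⟩
  · exact ha j ⟨l, hl, h⟩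

theorem card_codeClause_le (i : Fin k) (a : ℕ) :
    (codeClause i a : Clause (BVar k n)).card ≤ Nat.clog 2 n :=
  Finset.card_image_le.trans (by simp)

theorem size_binaryClique_le (G : SimpleGraph (Fin k × Fin n)) :
    (binaryClique G).size ≤ (k * 2 ^ Nat.clog 2 n) ^ 2 * (2 * Nat.clog 2 n) := by
  classical
  set L := Nat.clog 2 n
  let cl : (Fin k × Fin (2 ^ L)) × (Fin k × Fin (2 ^ L)) → Clause (BVar k n) := fun t =>
    codeClause t.1.1 t.1.2 ∪ codeClause t.2.1 t.2.2
  have hlt : ∀ a : Fin n, (a : ℕ) < 2 ^ L := fun a =>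
    a.2.trans_le (Nat.le_pow_clog (by norm_num) n)
  -- A range axiom is counted as the union of a code clause with itself.
  have hmem : ∀ C ∈ binaryClique G, C ∈ Finset.univ.image cl := by
    rintro C (⟨i, j, a, b, -, -, rfl⟩ | ⟨i, a, -, ha, rfl⟩)
    · exact Finset.mem_image.2
        ⟨((i, ⟨a, hlt a⟩), (j, ⟨b, hlt b⟩)), Finset.mem_univ _, rfl⟩
    · exact Finset.mem_image.2
        ⟨((i, ⟨a, ha⟩), (i, ⟨a, ha⟩)), Finset.mem_univ _, Finset.union_self _⟩
  have hcard : ∀ C ∈ Finset.univ.image cl, C.card ≤ 2 * L := by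
    intro C hC
    obtain ⟨t, -, rfl⟩ := Finset.mem_image.1 hC
    refine (Finset.card_union_le _ _).trans ?_
    have h1 := card_codeClause_le (n := n) t.1.1 t.1.2
    have h2 := card_codeClause_le (n := n) t.2.1 t.2.2
    omega
  rw [CNF.size]
  calc _ ≤ ∑ C ∈ Finset.univ.image cl, C.card := by
        refine Finset.sum_le_sum_of_subset fun C hC => ?_
        exact hmem C (Finset.mem_filter.1 hC).2
    _ ≤ (Finset.univ.image cl).card * (2 * L) := by
        rw [← smul_eq_mul]
        exact Finset.sum_le_card_nsmul _ _ _ hcard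
    _ ≤ _ := by
        refine Nat.mul_le_mul_right _ (Finset.card_image_le.trans (le_of_eq ?_))
        simp only [Finset.card_univ, Fintype.card_prod, Fintype.card_fin]
        ring

theorem extensionEdges_empty_univ_card (x : Fin k → Fin n) :
    (extensionEdges ∅ Finset.univ x).card = k.choose 2 := by
  classical
  set s : Finset (Fin k × Fin n) := Finset.univ.image fun i => (i, x i)
  have hs : s.card = k := by
    rw [Finset.card_image_of_injective _ fun i j h => congrArg Prod.fst h]
    simp
  have hchoose : s.card.choose 2 = k.choose 2 := by rw [hs]
  rw [← hchoose, ← Sym2.card_image_offDiag]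
  congr 1
  ext e
  simp only [mem_extensionEdges, Finset.mem_image, Finset.mem_offDiag, Prod.exists, s]
  constructor
  · rintro ⟨i, -, j, -, hij, -, rfl⟩
    exact ⟨i, x i, j, x j, ⟨⟨i, Finset.mem_univ _, rfl⟩, ⟨j, Finset.mem_univ _, rfl⟩,
      fun h => hij (congrArg Prod.fst h)⟩, rfl⟩
  · rintro ⟨i, a, j, b, ⟨⟨i', -, hi⟩, ⟨j', -, hj⟩, hne⟩, rfl⟩
    obtain ⟨rfl, rfl⟩ := Prod.mk.inj hi
    obtain ⟨rfl, rfl⟩ := Prod.mk.inj hj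
    exact ⟨i', Finset.mem_univ _, j', Finset.mem_univ _, fun h => hne (by rw [h]), by simp, rfl⟩

theorem randomPartite_satisfiable_le (p : unitInterval) :
    randomPartite n k p {G | (binaryClique G).Satisfiable} ≤
      ENNReal.ofReal ((n : ℝ) ^ k * (p : ℝ) ^ k.choose 2) := by
  classical
  have hpp := fun e => pairProb_mem (k := k) (n := n) p.2.1 p.2.2 e
  refine (randomPartite_le_prob p _
    (fun R => ∃ x ∈ (Finset.univ : Finset (Fin k → Fin n)), extensionEdges ∅ Finset.univ x ⊆ R)
    ?_).trans (ENNReal.ofReal_le_ofReal ?_)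
  · intro G hG
    obtain ⟨x, hx⟩ := exists_clique_of_satisfiable hG
    refine ⟨x, Finset.mem_univ _, fun e he => ?_⟩
    obtain ⟨i, hi, j, hj, hij, -, rfl⟩ := mem_extensionEdges.1 he
    exact SimpleGraph.mem_edgeFinset.2 (hx i hi j hj hij).1
  · refine (RandomSubset.prob_exists_le hpp _ _).trans (le_of_eq ?_)
    simp only [RandomSubset.prob_subset]
    rw [Finset.sum_congr rfl fun x _ => by
      rw [prod_pairProb fun e he => not_isDiag_of_mem_extensionEdges he,
        extensionEdges_empty_univ_card]]
    simp

/-- Short tree-like refutations of the binary clique formula of a random graph are unlikely. -/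
theorem randomPartite_exists_refutation_le {l q : ℝ} {p : unitInterval} (hl : 2 < l) (hln : l ≤ n)
    (hk : 0 < k) (hp0 : 0 < (p : ℝ)) (hq : 1 ≤ q) (hkq : k * q ≤ l) {H : ℕ}
    (hpq : ∀ j : ℕ, (n : ℝ) ^ j ≤ 4 ^ H * l ^ j → 1 ≤ q * (p : ℝ) ^ j) (d : ℕ) :
    randomPartite n k p {G | ∃ π : TreeLikeThRefutation d (binaryClique G),
        π.length * 2 ^ H < 3 ^ H + 2 ^ H} ≤
      ENNReal.ofReal (H * (((n : ℝ) ^ k + 1) ^ (lowDegreeMonomials (BVar k n) d).card *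
        (2 * (2 ^ k * (n : ℝ) ^ k))) ^ H *
        Real.exp (1 / 2 - 1 / (2 * (16 * k * (k ^ 2 + 1) * q / l)))) := by
  classical
  have hn : 0 < n := by
    have : (0 : ℝ) < n := by linarith
    exact_mod_cast this
  set B := thresholdSets (encode : (Fin k → Fin n) → BVar k n → Bool) d
  have hB : B.Nonempty := by
    refine ⟨Finset.univ, ?_⟩
    simp only [B, thresholdSets, Finset.mem_filter, Finset.mem_univ, true_and, true_iff]
    exact ⟨0, by simp, fun x => by simp [Holds]⟩
  have hmono : randomPartite n k p {G | ∃ π : TreeLikeThRefutation d (binaryClique G),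
      π.length * 2 ^ H < 3 ^ H + 2 ^ H} ≤ randomPartite n k p {G | ¬ IsGood l H B G} := by
    refine MeasureTheory.measure_mono ?_
    rintro G ⟨π, hπ⟩ hgood
    exact hgood.not_solves hl hln
      ((π.solves encode H hπ).mono fun Y hY => hY.containsNonEdge)
  refine hmono.trans ((randomPartite_not_isGood_le (by linarith) hn hk hp0 hq hkq hpq hB).trans
    (ENNReal.ofReal_le_ofReal ?_))
  have hBcard : (B.card : ℝ) ≤ ((n : ℝ) ^ k + 1) ^ (lowDegreeMonomials (BVar k n) d).card := by
    have := card_thresholdSets_le (encode : (Fin k → Fin n) → BVar k n → Bool) d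
    rw [Fintype.card_pi, Finset.prod_const, Finset.card_univ, Fintype.card_fin,
      Fintype.card_fin] at this
    exact_mod_cast this
  push_cast
  gcongr

end CliqueTh

/-! ### Asymptotics -/

namespace CliqueTh

theorem natCast_eq_two_rpow {n : ℕ} (hn : 0 < n) : (n : ℝ) = 2 ^ Real.logb 2 n :=
  (Real.rpow_logb (by norm_num) (by norm_num) (by exact_mod_cast hn)).symm

theorem two_rpow_le_exp {x : ℝ} (hx : 0 ≤ x) : (2 : ℝ) ^ x ≤ Real.exp x := by
  rw [Real.rpow_def_of_pos (by norm_num), Real.exp_le_exp]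
  have : Real.log 2 ≤ 1 := by linarith [Real.log_two_lt_d9]
  nlinarith

/-- Here x = log n and y = n^(1/10). The summands are the logarithms of bounds for the number of
rounds, for the number of states and for the Janson probability. The last is at most 1/2 - 15 x^6
y^7, since 960 x^12 ≤ y, and dominates the others. -/
theorem exponent_le {x y k M H : ℝ} (hx : 1 ≤ x) (hy : 1000 * x ^ 12 ≤ y) (hk1 : 1 ≤ k)
    (hk : k ≤ x ^ 2) (hM0 : 0 ≤ M) (hM : M ≤ y ^ 6) (hH0 : 0 ≤ H) (hH : H ≤ x ^ 2) :
    x ^ 2 + ((k * x + 1) * M + (1 + k + k * x)) * H +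
      (1 / 2 - 1 / (2 * (16 * k * (k ^ 2 + 1) * y / y ^ 9))) ≤ -x := by
  have hx12 : 1 ≤ x ^ 12 := one_le_pow₀ hx
  have hx0 : 0 < x := by linarith
  have hy1 : 1 ≤ y := by linarith
  have hy0 : 0 < y := by linarith
  have hx2 : x ≤ x ^ 2 := le_self_pow₀ hx (by norm_num)
  have hx3 : 1 ≤ x ^ 3 := one_le_pow₀ hx
  have hx23 : x ^ 2 ≤ x ^ 3 := pow_le_pow_right₀ hx (by norm_num)
  have hkx : k * x ≤ x ^ 3 := by
    calc k * x ≤ x ^ 2 * x := mul_le_mul_of_nonneg_right hk hx0.le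
      _ = x ^ 3 := by ring
  have hy6 : 1 ≤ y ^ 6 := one_le_pow₀ hy1
  have h1 : (k * x + 1) * M + (1 + k + k * x) ≤ 5 * x ^ 3 * y ^ 6 := by
    have h11 : (k * x + 1) * M ≤ 2 * x ^ 3 * y ^ 6 :=
      mul_le_mul (by linarith) hM hM0 (by positivity)
    have h12 : 3 * x ^ 3 * 1 ≤ 3 * x ^ 3 * y ^ 6 := mul_le_mul_of_nonneg_left hy6 (by positivity)
    linarith
  have h2 : ((k * x + 1) * M + (1 + k + k * x)) * H ≤ 5 * x ^ 5 * y ^ 6 := by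
    calc _ ≤ 5 * x ^ 3 * y ^ 6 * x ^ 2 := mul_le_mul h1 hH hH0 (by positivity)
      _ = _ := by ring
  have hkk : k * (k ^ 2 + 1) ≤ 2 * x ^ 6 := by
    have h21 : k ^ 2 ≤ x ^ 4 := by
      calc k ^ 2 ≤ (x ^ 2) ^ 2 := pow_le_pow_left₀ (by linarith) hk 2
        _ = x ^ 4 := by ring
    have hx4 : 1 ≤ x ^ 4 := one_le_pow₀ hx
    calc k * (k ^ 2 + 1) ≤ x ^ 2 * (2 * x ^ 4) :=
          mul_le_mul hk (by linarith) (by positivity) (by positivity)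
      _ = _ := by ring
  have h3 : 15 * x ^ 6 * y ^ 7 ≤ 1 / (2 * (16 * k * (k ^ 2 + 1) * y / y ^ 9)) := by
    have hk0 : 0 < k := by linarith
    have heq : 1 / (2 * (16 * k * (k ^ 2 + 1) * y / y ^ 9)) =
        y ^ 8 / (32 * (k * (k ^ 2 + 1))) := by
      field_simp
      ring
    rw [heq, le_div_iff₀ (by positivity)]
    calc 15 * x ^ 6 * y ^ 7 * (32 * (k * (k ^ 2 + 1))) ≤
          15 * x ^ 6 * y ^ 7 * (32 * (2 * x ^ 6)) := by gcongr
      _ = y ^ 7 * (960 * x ^ 12) := by ring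
      _ ≤ y ^ 7 * y := by
          refine mul_le_mul_of_nonneg_left ?_ (by positivity)
          linarith
      _ = y ^ 8 := by ring
  have h5 : x ^ 5 * y ^ 6 ≤ x ^ 6 * y ^ 7 :=
    mul_le_mul (pow_le_pow_right₀ hx (by norm_num)) (pow_le_pow_right₀ hy1 (by norm_num))
      (by positivity) (by positivity)
  have h6 : x ^ 2 ≤ x ^ 6 * y ^ 7 := by
    calc x ^ 2 = x ^ 2 * 1 := (mul_one _).symm
      _ ≤ x ^ 6 * y ^ 7 := mul_le_mul (pow_le_pow_right₀ hx (by norm_num)) (one_le_pow₀ hy1)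
        zero_le_one (by positivity)
  linarith

theorem rpow_le_three_halves_pow {z : ℝ} {H : ℕ} (hH : 2 * z ≤ H) :
    (2 : ℝ) ^ z ≤ (3 / 2) ^ H := by
  have h1 : (2 : ℝ) ^ z ≤ 2 ^ ((H : ℝ) / 2) :=
    Real.rpow_le_rpow_of_exponent_le (by norm_num) (by linarith)
  refine h1.trans ?_
  have h2 : (2 : ℝ) ^ ((H : ℝ) / 2) = (2 ^ (1 / 2 : ℝ)) ^ H := by
    rw [← Real.rpow_natCast, ← Real.rpow_mul (by norm_num)]
    congr 1
    ring
  rw [h2]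
  refine pow_le_pow_left₀ (by positivity) ?_ H
  rw [← Real.sqrt_eq_rpow]
  exact (Real.sqrt_le_left (by norm_num)).2 (by norm_num)

/-- For large `n`, short tree-like refutations exist with probability at most `exp (-log₂ n)`. -/
theorem randomPartite_short_refutation_le {n k D d : ℕ} (hn : 0 < n)
    (hx : 800 ≤ Real.logb 2 n)
    (hy : 1000 * Real.logb 2 n ^ 12 ≤ 2 ^ (Real.logb 2 n / 10))
    (hD1 : 1 ≤ D) (hD : (D : ℝ) ≤ 2 * Real.logb 2 n) (hk1 : 1 ≤ k)
    (hk : (k : ℝ) ≤ Real.logb 2 n ^ 2)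
    (hM : ((lowDegreeMonomials (BVar k n) d).card : ℝ) ≤ (2 ^ (Real.logb 2 n / 10)) ^ 6) :
    randomPartite n k (edgeProb n D) {G | ∃ π : TreeLikeThRefutation d (binaryClique G),
        (π.length : ℝ) < (n : ℝ) ^ ((D : ℝ) / 1600)} ≤
      ENNReal.ofReal (Real.exp (-Real.logb 2 n)) := by
  set x := Real.logb 2 n with hxdef
  set y : ℝ := 2 ^ (x / 10) with hydef
  set M := (lowDegreeMonomials (BVar k n) d).card
  -- `H` is large enough that (3/2)^H ≥ 2^(H/2) ≥ n^(D/1600), and small enough that 4^H ≤ n^(D/200).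
  set H := ⌊(D : ℝ) * x / 400⌋₊ with hHdef
  have hnx : (n : ℝ) = 2 ^ x := natCast_eq_two_rpow hn
  have hx0 : 0 < x := by linarith
  have hD1' : (1 : ℝ) ≤ D := by exact_mod_cast hD1
  have hk1' : (1 : ℝ) ≤ k := by exact_mod_cast hk1
  have hny : (n : ℝ) = y ^ 10 := by
    rw [hnx, hydef, ← Real.rpow_natCast, ← Real.rpow_mul (by norm_num)]
    congr 1
    push_cast
    ring
  have hypos : 0 < y := by positivity
  have hx12 : x ^ 2 ≤ x ^ 12 := pow_le_pow_right₀ (by linarith) (by norm_num)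
  have hx2 : (1 : ℝ) ≤ x ^ 2 := one_le_pow₀ (by linarith)
  have hy1 : 1000 ≤ y := by linarith
  have hxy : x ^ 2 ≤ y := by linarith
  have hDx0 : (0 : ℝ) ≤ D * x / 400 := by positivity
  have hHle : (H : ℝ) ≤ D * x / 400 := Nat.floor_le hDx0
  have hHx : (H : ℝ) ≤ x ^ 2 := by nlinarith
  have hHge : D * x / 800 ≤ (H : ℝ) := by
    have := Nat.lt_floor_add_one ((D : ℝ) * x / 400)
    nlinarith
  have hp : (edgeProb n D : ℝ) = 2 ^ (-(2 * x / D)) := by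
    change (n : ℝ) ^ (-2 / (D : ℝ)) = _
    rw [hnx, ← Real.rpow_mul (by norm_num)]
    congr 1
    ring
  have hmono : randomPartite n k (edgeProb n D) {G | ∃ π : TreeLikeThRefutation d (binaryClique G),
        (π.length : ℝ) < (n : ℝ) ^ ((D : ℝ) / 1600)} ≤
      randomPartite n k (edgeProb n D) {G | ∃ π : TreeLikeThRefutation d (binaryClique G),
        π.length * 2 ^ H < 3 ^ H + 2 ^ H} := by
    refine MeasureTheory.measure_mono ?_
    rintro G ⟨π, hπ⟩
    refine ⟨π, ?_⟩
    have h1 : (n : ℝ) ^ ((D : ℝ) / 1600) ≤ (3 / 2) ^ H := by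
      rw [hnx, ← Real.rpow_mul (by norm_num)]
      refine rpow_le_three_halves_pow ?_
      linarith
    have h2 : (π.length : ℝ) * 2 ^ H < 3 ^ H := by
      have h3 := mul_lt_mul_of_pos_right (hπ.trans_le h1) (show (0 : ℝ) < 2 ^ H by positivity)
      rwa [← mul_pow, show (3 / 2 : ℝ) * 2 = 3 by norm_num] at h3
    have h4 : π.length * 2 ^ H < 3 ^ H := by exact_mod_cast h2
    exact h4.trans_le (Nat.le_add_right _ _)
  refine hmono.trans ((randomPartite_exists_refutation_le (l := y ^ 9) (q := y) ?_ ?_ hk1 ?_ ?_ ?_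
    (H := H) ?_ d).trans (ENNReal.ofReal_le_ofReal ?_))
  · exact lt_of_lt_of_le (by linarith) (le_self_pow₀ (by linarith) (by norm_num : (9 : ℕ) ≠ 0))
  · rw [hny]
    exact pow_le_pow_right₀ (by linarith) (by norm_num)
  · rw [hp]
    positivity
  · linarith
  · calc (k : ℝ) * y ≤ y * y := mul_le_mul_of_nonneg_right (hk.trans hxy) hypos.le
      _ = y ^ 2 := by ring
      _ ≤ y ^ 9 := pow_le_pow_right₀ (by linarith) (by norm_num)
  -- Since n/l = y, the hypothesis reads y^j ≤ 4^H ≤ n^(D/200), so j ≤ D/20; then p^j = n^(-2j/D) ≥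
  -- n^(-1/10) = 1/y.
  · intro j hj
    have h1 : y ^ j ≤ 4 ^ H := by
      rw [hny, ← pow_mul, ← pow_mul, show 10 * j = j + 9 * j by ring, pow_add] at hj
      exact le_of_mul_le_mul_right hj (by positivity)
    have h2 : (2 : ℝ) ^ (x / 10 * j) ≤ 2 ^ (2 * (D * x / 400)) := by
      have h3 : (2 : ℝ) ^ (x / 10 * j) = y ^ j := by
        rw [hydef, ← Real.rpow_natCast, ← Real.rpow_mul (by norm_num)]
      have h4 : (4 : ℝ) ^ H = 2 ^ (2 * (H : ℝ)) := by
        rw [Real.rpow_mul (by norm_num), Real.rpow_natCast]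
        norm_num
      rw [h3]
      refine h1.trans ?_
      rw [h4]
      exact Real.rpow_le_rpow_of_exponent_le (by norm_num) (by linarith)
    have h5 : x / 10 * j ≤ 2 * (D * x / 400) :=
      (Real.rpow_le_rpow_left_iff (by norm_num : (1 : ℝ) < 2)).1 h2
    have h6 : (j : ℝ) ≤ D / 20 := by
      by_contra! h
      have := mul_lt_mul_of_pos_left h (show 0 < x / 10 by positivity)
      linarith
    rw [hp, ← Real.rpow_natCast, ← Real.rpow_mul (by norm_num), hydef,
      ← Real.rpow_add (by norm_num)]
    refine Real.one_le_rpow (by norm_num) ?_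
    have h7 : 2 * x / D * j ≤ 2 * x / D * (D / 20) := mul_le_mul_of_nonneg_left h6 (by positivity)
    have h8 : 2 * x / D * (D / 20) = x / 10 := by
      field_simp
      ring
    linarith
  · have hnexp : (n : ℝ) ≤ Real.exp x := by
      rw [hnx]
      exact two_rpow_le_exp hx0.le
    have hnk : (n : ℝ) ^ k ≤ Real.exp (k * x) := by
      rw [Real.exp_nat_mul]
      exact pow_le_pow_left₀ (by positivity) hnexp k
    have hkx : 0 ≤ k * x := by positivity
    have h1 : (n : ℝ) ^ k + 1 ≤ Real.exp (k * x + 1) := by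
      have h2 := Real.add_one_le_exp (1 : ℝ)
      have h3 := Real.one_le_exp hkx
      rw [Real.exp_add]
      nlinarith
    have h2 : 2 * (2 ^ k * (n : ℝ) ^ k) ≤ Real.exp (1 + k + k * x) := by
      rw [Real.exp_add, Real.exp_add, mul_assoc]
      have h3 : (2 : ℝ) ≤ Real.exp 1 := by linarith [Real.add_one_le_exp (1 : ℝ)]
      have h4 : (2 : ℝ) ^ k ≤ Real.exp k := by
        rw [← Real.exp_one_pow]
        exact pow_le_pow_left₀ (by norm_num) h3 k
      gcongr
    have h3 : (((n : ℝ) ^ k + 1) ^ M * (2 * (2 ^ k * (n : ℝ) ^ k))) ^ H ≤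
        Real.exp (((k * x + 1) * M + (1 + k + k * x)) * H) := by
      rw [mul_comm _ (H : ℝ), Real.exp_nat_mul]
      refine pow_le_pow_left₀ (by positivity) ?_ H
      rw [Real.exp_add, mul_comm _ (M : ℝ), Real.exp_nat_mul]
      gcongr
    have h4 : (H : ℝ) ≤ Real.exp (x ^ 2) := by linarith [Real.add_one_le_exp (x ^ 2)]
    calc _ ≤ Real.exp (x ^ 2) * Real.exp (((k * x + 1) * M + (1 + k + k * x)) * H) *
          Real.exp (1 / 2 - 1 / (2 * (16 * k * (k ^ 2 + 1) * y / y ^ 9))) := by gcongr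
      _ ≤ _ := by
        rw [← Real.exp_add, ← Real.exp_add, Real.exp_le_exp]
        exact exponent_le (by linarith) hy hk1' hk (Nat.cast_nonneg M) hM (Nat.cast_nonneg H) hHx

theorem tendsto_logb_natCast : Tendsto (fun n : ℕ => Real.logb 2 n) atTop atTop :=
  (Real.tendsto_logb_atTop (by norm_num)).comp tendsto_natCast_atTop_atTop

theorem eventually_pow_le_two_rpow (C : ℝ) (m : ℕ) {b : ℝ} (hb : 0 < b) :
    ∀ᶠ x : ℝ in atTop, C * x ^ m ≤ 2 ^ (b * x) := by
  have hb' : 0 < b * Real.log 2 := mul_pos hb (Real.log_pos (by norm_num))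
  have h := (isLittleO_pow_exp_pos_mul_atTop m hb').const_mul_left C
  filter_upwards [h.bound one_pos] with x hx
  rw [Real.rpow_def_of_pos (by norm_num)]
  have h1 := (le_abs_self _).trans hx
  rw [one_mul, Real.norm_of_nonneg (Real.exp_pos _).le] at h1
  exact h1.trans (le_of_eq (by ring_nf))

/-- Random binary clique formulas have no short tree-like refutations with high probability. -/
theorem tendsto_randomPartite_short_refutation {D k d : ℕ → ℕ}
    (hD : ∀ᶠ n : ℕ in atTop, 1 ≤ D n ∧ (D n : ℝ) ≤ 2 * Real.logb 2 n)
    (hk : ∀ᶠ n : ℕ in atTop, 1 ≤ k n ∧ (k n : ℝ) ≤ Real.logb 2 n ^ 2)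
    (hM : ∀ᶠ n : ℕ in atTop, ((lowDegreeMonomials (BVar (k n) n) (d n)).card : ℝ) ≤
      2 ^ (6 / 10 * Real.logb 2 n)) :
    Tendsto (fun n : ℕ => randomPartite n (k n) (edgeProb n (D n))
      {G | ∃ π : TreeLikeThRefutation (d n) (binaryClique G),
        (π.length : ℝ) < (n : ℝ) ^ ((D n : ℝ) / 1600)}) atTop (𝓝 0) := by
  have h0 : Tendsto (fun n : ℕ => ENNReal.ofReal (Real.exp (-Real.logb 2 n))) atTop (𝓝 0) := by
    rw [← ENNReal.ofReal_zero]
    exact ENNReal.tendsto_ofReal (Real.tendsto_exp_neg_atTop_nhds_zero.comp tendsto_logb_natCast)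
  refine tendsto_of_tendsto_of_tendsto_of_le_of_le' tendsto_const_nhds h0
    (Eventually.of_forall fun _ => zero_le) ?_
  filter_upwards [hD, hk, hM, eventually_gt_atTop 0,
    tendsto_logb_natCast.eventually_ge_atTop 800, tendsto_logb_natCast.eventually
      (eventually_pow_le_two_rpow 1000 12 (show (0 : ℝ) < 1 / 10 by norm_num))]
    with n hD hk hM hn hx hy
  refine randomPartite_short_refutation_le hn hx (hy.trans (le_of_eq ?_)) hD.1 hD.2 hk.1 hk.2
    (hM.trans (le_of_eq ?_))
  · congr 1
    ring
  · rw [← Real.rpow_natCast, ← Real.rpow_mul (by norm_num)]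
    congr 1
    push_cast
    ring

end CliqueTh

/-! ### Counting low-degree monomials; size and unsatisfiability of the formula -/

namespace CliqueTh

/-- Chernoff-style weighting: each counted set has t^|S| ≥ t^d, and all sets together have weight (1
+ t)^|V|. -/
theorem card_lowDegreeMonomials_le (V : Type) [Fintype V] [DecidableEq V] (d : ℕ) {t : ℝ}
    (ht0 : 0 < t) (ht1 : t ≤ 1) :
    ((lowDegreeMonomials V d).card : ℝ) ≤ (1 / t) ^ d * Real.exp (t * Fintype.card V) := by
  have h1 : t ^ d * ((lowDegreeMonomials V d).card : ℝ) ≤ (t + 1) ^ Fintype.card V := by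
    have h := Finset.sum_pow_mul_eq_add_pow t 1 (Finset.univ : Finset V)
    simp only [one_pow, mul_one, Finset.powerset_univ, Finset.card_univ] at h
    rw [← h, mul_comm, ← nsmul_eq_mul]
    refine (Finset.card_nsmul_le_sum (lowDegreeMonomials V d) (fun S => t ^ S.card) _ ?_).trans
      (Finset.sum_le_sum_of_subset_of_nonneg (Finset.subset_univ _) fun S _ _ => by positivity)
    intro S hS
    exact pow_le_pow_of_le_one ht0.le ht1 (Finset.mem_filter.1 hS).2
  have h2 : (t + 1) ^ Fintype.card V ≤ Real.exp (t * Fintype.card V) := by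
    rw [mul_comm, Real.exp_nat_mul]
    exact pow_le_pow_left₀ (by linarith) (Real.add_one_le_exp t) _
  rw [one_div, inv_pow, ← div_eq_inv_mul, le_div_iff₀ (pow_pos ht0 d), mul_comm]
  exact h1.trans h2

theorem card_bVar (k n : ℕ) : Fintype.card (BVar k n) = k * Nat.clog 2 n := by
  simp

theorem clog_le (n : ℕ) (hx : 1 ≤ Real.logb 2 n) :
    (Nat.clog 2 n : ℝ) ≤ Real.logb 2 n + 1 := by
  have h := Real.natCeil_logb_natCast 2 n
  push_cast at h
  rw [← h]
  exact (Nat.ceil_lt_add_one (by linarith)).le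

theorem exp_le_two_rpow {z : ℝ} (hz : 0 ≤ z) : Real.exp z ≤ 2 ^ (2 * z) := by
  rw [Real.rpow_def_of_pos (by norm_num), Real.exp_le_exp]
  nlinarith [Real.log_two_gt_d9]

/-- There are few multilinear monomials of degree at most `log n / (2 log log n)`. -/
theorem eventually_card_lowDegreeMonomials_le {k : ℕ → ℕ} {C : ℝ} (hC : 1 ≤ C)
    (hk : ∀ᶠ n : ℕ in atTop, (k n : ℝ) ≤ C * Real.logb 2 n) :
    ∀ᶠ n : ℕ in atTop, ((lowDegreeMonomials (BVar (k n) n)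
      ⌊Real.logb 2 n / (2 * Real.logb 2 (Real.logb 2 n))⌋₊).card : ℝ) ≤
      2 ^ (6 / 10 * Real.logb 2 n) := by
  -- With t = 1/(Ax) the two factors of the monomial bound are at most 2^(0.51 x) and 2^(x/20).
  set A := 80 * C with hA
  have hloglog : Tendsto (fun n : ℕ => Real.logb 2 (Real.logb 2 n)) atTop atTop :=
    (Real.tendsto_logb_atTop (by norm_num)).comp tendsto_logb_natCast
  filter_upwards [hk, tendsto_logb_natCast.eventually_ge_atTop 1,
    hloglog.eventually_ge_atTop (50 * Real.logb 2 A), hloglog.eventually_ge_atTop 1]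
    with n hk hx hA1 hy
  set x := Real.logb 2 n
  set y := Real.logb 2 x
  set d := ⌊x / (2 * y)⌋₊
  have hAx : 1 ≤ A * x := by nlinarith
  have hd : (d : ℝ) ≤ x / (2 * y) := Nat.floor_le (by positivity)
  refine (card_lowDegreeMonomials_le _ d (t := 1 / (A * x)) (by positivity)
    ((div_le_one (by positivity)).2 hAx)).trans ?_
  rw [one_div_one_div, card_bVar]
  have h1 : (A * x) ^ d ≤ 2 ^ (51 / 100 * x) := by
    have hlog : Real.logb 2 (A * x) = Real.logb 2 A + y :=
      Real.logb_mul (by positivity) (by positivity)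
    have h2 : (A * x : ℝ) = 2 ^ (Real.logb 2 A + y) := by
      rw [← hlog, Real.rpow_logb (by norm_num) (by norm_num) (by positivity)]
    rw [h2, ← Real.rpow_natCast, ← Real.rpow_mul (by norm_num)]
    refine Real.rpow_le_rpow_of_exponent_le (by norm_num) ?_
    have h3 : Real.logb 2 A + y ≤ 51 / 50 * y := by linarith
    calc (Real.logb 2 A + y) * d ≤ 51 / 50 * y * (x / (2 * y)) :=
          mul_le_mul h3 hd (Nat.cast_nonneg _) (by positivity)
      _ = 51 / 100 * x := by
          field_simp
          ring
  have h2 : Real.exp (1 / (A * x) * ((k n * Nat.clog 2 n : ℕ) : ℝ)) ≤ 2 ^ (1 / 20 * x) := by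
    have h3 : ((k n * Nat.clog 2 n : ℕ) : ℝ) ≤ C * x * (2 * x) := by
      push_cast
      exact mul_le_mul hk ((clog_le n hx).trans (by linarith)) (Nat.cast_nonneg _) (by positivity)
    have h4 : 1 / (A * x) * ((k n * Nat.clog 2 n : ℕ) : ℝ) ≤ x / 40 := by
      refine (mul_le_mul_of_nonneg_left h3 (by positivity)).trans (le_of_eq ?_)
      rw [hA]
      field_simp
      ring
    refine (Real.exp_le_exp.2 h4).trans ((exp_le_two_rpow (by positivity)).trans (le_of_eq ?_))
    congr 1
    ring
  refine (mul_le_mul h1 h2 (Real.exp_pos _).le (by positivity)).trans ?_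
  rw [← Real.rpow_add (by norm_num)]
  exact Real.rpow_le_rpow_of_exponent_le (by norm_num) (by linarith)

/-- There are few multilinear monomials whose degree is a small power of the number of variables,
if there are few blocks. -/
theorem eventually_card_lowDegreeMonomials_rpow_le {ε : ℝ} (hε0 : 0 < ε) (hε1 : ε < 1)
    {k : ℕ → ℕ} (hk : ∀ᶠ n : ℕ in atTop, (k n : ℝ) ≤ 4 * Real.logb 2 n ^ ε) :
    ∀ᶠ n : ℕ in atTop, ((lowDegreeMonomials (BVar (k n) n)
      ⌊(Fintype.card (BVar (k n) n) : ℝ) ^ (1 - ε)⌋₊).card : ℝ) ≤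
      2 ^ (6 / 10 * Real.logb 2 n) := by
  -- The degree is O(x^(1-ε²)), because (1 + ε)(1 - ε) = 1 - ε²; the spare factor x^(ε²) absorbs the
  -- logarithm coming from t = 1/x².
  have hlog : ∀ᶠ x : ℝ in atTop, Real.logb 2 x ≤ 1 / 100 * x ^ (ε ^ 2) := by
    have h := (isLittleO_log_rpow_atTop (show 0 < ε ^ 2 by positivity)).bound
      (show (0 : ℝ) < 1 / 200 by norm_num)
    filter_upwards [h, eventually_gt_atTop 1] with x hx hx1
    rw [Real.norm_of_nonneg (by positivity : (0 : ℝ) ≤ x ^ (ε ^ 2))] at hx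
    have h1 := (le_abs_self _).trans hx
    rw [Real.logb, div_le_iff₀ (Real.log_pos (by norm_num))]
    have h2 : (0 : ℝ) ≤ x ^ (ε ^ 2) := by positivity
    nlinarith [Real.log_two_gt_d9]
  filter_upwards [hk, tendsto_logb_natCast.eventually_ge_atTop 100,
    tendsto_logb_natCast.eventually hlog] with n hk hx hlog
  set x := Real.logb 2 n
  set N := Fintype.card (BVar (k n) n) with hN
  set d := ⌊(N : ℝ) ^ (1 - ε)⌋₊
  have hx0 : 0 < x := by linarith
  have hNle : (N : ℝ) ≤ 8 * x ^ (1 + ε) := by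
    rw [hN, card_bVar]
    push_cast
    calc (k n : ℝ) * Nat.clog 2 n ≤ 4 * x ^ ε * (2 * x) :=
          mul_le_mul hk ((clog_le n (by linarith)).trans (by linarith)) (Nat.cast_nonneg _)
            (by positivity)
      _ = _ := by
          rw [Real.rpow_add hx0, Real.rpow_one]
          ring
  have hNx : (N : ℝ) ≤ 8 * x ^ 2 := by
    refine hNle.trans (mul_le_mul_of_nonneg_left ?_ (by norm_num))
    rw [← Real.rpow_two]
    exact Real.rpow_le_rpow_of_exponent_le (by linarith) (by linarith)
  have hd : (d : ℝ) ≤ 8 * x ^ (1 - ε ^ 2) := by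
    refine (Nat.floor_le (by positivity)).trans ?_
    refine (Real.rpow_le_rpow (Nat.cast_nonneg _) hNle (by linarith)).trans ?_
    rw [Real.mul_rpow (by norm_num) (by positivity), ← Real.rpow_mul hx0.le]
    have h8 : (8 : ℝ) ^ (1 - ε) ≤ 8 := by
      calc (8 : ℝ) ^ (1 - ε) ≤ 8 ^ (1 : ℝ) :=
            Real.rpow_le_rpow_of_exponent_le (by norm_num) (by linarith)
        _ = 8 := Real.rpow_one 8
    rw [show (1 + ε) * (1 - ε) = 1 - ε ^ 2 by ring]
    exact mul_le_mul_of_nonneg_right h8 (by positivity)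
  refine (card_lowDegreeMonomials_le _ d (t := 1 / x ^ 2) (by positivity)
    ((div_le_one (by positivity)).2 (one_le_pow₀ (by linarith)))).trans ?_
  rw [one_div_one_div, ← hN]
  have h1 : (x ^ 2) ^ d ≤ 2 ^ (16 / 100 * x) := by
    have h2 : x = 2 ^ Real.logb 2 x := (Real.rpow_logb (by norm_num) (by norm_num) hx0).symm
    have h3 : (x ^ 2) ^ d = 2 ^ (Real.logb 2 x * (2 * d)) := by
      rw [Real.rpow_mul (by norm_num), ← h2, ← pow_mul, ← Real.rpow_natCast]
      push_cast
      rfl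
    rw [h3]
    refine Real.rpow_le_rpow_of_exponent_le (by norm_num) ?_
    calc Real.logb 2 x * (2 * d) ≤ 1 / 100 * x ^ (ε ^ 2) * (2 * (8 * x ^ (1 - ε ^ 2))) := by
          gcongr
      _ = 16 / 100 * (x ^ (ε ^ 2) * x ^ (1 - ε ^ 2)) := by ring
      _ = 16 / 100 * x := by
          rw [← Real.rpow_add hx0]
          simp
  have h2 : Real.exp (1 / x ^ 2 * N) ≤ 2 ^ (16 : ℝ) := by
    have h3 : 1 / x ^ 2 * N ≤ 8 := by
      rw [one_div_mul_eq_div, div_le_iff₀ (by positivity)]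
      exact hNx
    refine (Real.exp_le_exp.2 h3).trans ((exp_le_two_rpow (by norm_num)).trans (le_of_eq ?_))
    norm_num
  refine (mul_le_mul h1 h2 (Real.exp_pos _).le (by positivity)).trans ?_
  rw [← Real.rpow_add (by norm_num)]
  exact Real.rpow_le_rpow_of_exponent_le (by norm_num) (by linarith)

/-- A refutation in a weaker system is one in a stronger system. -/
def TreeLikeThRefutation.ofLE {V : Type} {d d' : ℕ} {A : CNF V} (π : TreeLikeThRefutation d A)
    (h : d ≤ d') : TreeLikeThRefutation d' A :=
  { π with degree_le := fun i => (π.degree_le i).trans h }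

/-- The binary clique formula has size at most `n ^ 3`. -/
theorem size_binaryClique_le_pow {k n : ℕ} (hn : 0 < n) (hx : 1 ≤ Real.logb 2 n)
    (hk : (k : ℝ) ≤ Real.logb 2 n ^ 2) (h : 16 * Real.logb 2 n ^ 5 ≤ 2 ^ Real.logb 2 n)
    (G : SimpleGraph (Fin k × Fin n)) : ((binaryClique G).size : ℝ) ≤ (n : ℝ) ^ 3 := by
  set x := Real.logb 2 n
  have hclog : (Nat.clog 2 n : ℝ) ≤ x + 1 := clog_le n hx
  have hpow : (2 : ℝ) ^ Nat.clog 2 n ≤ 2 * n := by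
    rw [natCast_eq_two_rpow hn, ← Real.rpow_natCast]
    refine (Real.rpow_le_rpow_of_exponent_le (by norm_num) hclog).trans (le_of_eq ?_)
    rw [Real.rpow_add (by norm_num), Real.rpow_one, mul_comm]
  have hsize : ((binaryClique G).size : ℝ) ≤
      ((k : ℝ) * 2 ^ Nat.clog 2 n) ^ 2 * (2 * Nat.clog 2 n) := by
    exact_mod_cast size_binaryClique_le G
  refine hsize.trans ?_
  calc ((k : ℝ) * 2 ^ Nat.clog 2 n) ^ 2 * (2 * Nat.clog 2 n) ≤
        (x ^ 2 * (2 * n)) ^ 2 * (2 * (2 * x)) := by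
        gcongr
        linarith
    _ = 16 * x ^ 5 * (n : ℝ) ^ 2 := by ring
    _ ≤ n * (n : ℝ) ^ 2 := by
        refine mul_le_mul_of_nonneg_right ?_ (by positivity)
        rw [natCast_eq_two_rpow hn]
        exact h
    _ = _ := by ring

/-- A random graph with twice as many blocks as `D` almost surely contains no clique. -/
theorem tendsto_randomPartite_satisfiable {D k : ℕ → ℕ} (hD : ∀ᶠ n in atTop, 2 ≤ D n)
    (hk : ∀ n, k n = 2 * D n) :
    Tendsto (fun n : ℕ => randomPartite n (k n) (edgeProb n (D n))
      {G | (binaryClique G).Satisfiable}) atTop (𝓝 0) := by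
  have h0 : Tendsto (fun n : ℕ => ENNReal.ofReal ((n : ℝ)⁻¹)) atTop (𝓝 0) := by
    rw [← ENNReal.ofReal_zero]
    exact ENNReal.tendsto_ofReal tendsto_inv_atTop_nhds_zero_nat
  refine tendsto_of_tendsto_of_tendsto_of_le_of_le' tendsto_const_nhds h0
    (Eventually.of_forall fun _ => zero_le) ?_
  filter_upwards [hD, eventually_gt_atTop 0] with n hD hn
  refine (randomPartite_satisfiable_le _).trans (ENNReal.ofReal_le_ofReal ?_)
  have hn' : (0 : ℝ) < n := by exact_mod_cast hn
  have hn1 : (1 : ℝ) ≤ n := by exact_mod_cast hn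
  have hD' : (2 : ℝ) ≤ D n := by exact_mod_cast hD
  have hchoose : (k n).choose 2 = D n * (2 * D n - 1) := by
    rw [hk, Nat.choose_two_right, mul_assoc, Nat.mul_div_cancel_left _ (by norm_num)]
  change (n : ℝ) ^ k n * ((n : ℝ) ^ (-2 / (D n : ℝ))) ^ (k n).choose 2 ≤ _
  rw [hchoose, hk, ← Real.rpow_natCast, ← Real.rpow_natCast, ← Real.rpow_mul hn'.le,
    ← Real.rpow_add hn', ← Real.rpow_neg_one]
  refine Real.rpow_le_rpow_of_exponent_le hn1 ?_
  rw [Nat.cast_mul (D n), Nat.cast_sub (by omega)]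
  push_cast
  -- The total exponent is 2D - 2(2D - 1) = 2 - 2D, which is at most -1 for D ≥ 2.
  have : -2 / (D n : ℝ) * (D n * (2 * D n - 1)) = -2 * (2 * D n - 1) := by
    field_simp
  rw [this]
  linarith

end CliqueTh

/-! ### The two asymptotic statements -/

open CliqueTh in
theorem corollary4p6 :
    (∃ c : ℝ, 0 < c ∧ ∀ D k : ℕ → ℕ,
      (∀ᶠ n : ℕ in atTop, 1 ≤ D n ∧ (D n : ℝ) ≤ 2 * Real.logb 2 n) →
      (fun n => (k n : ℝ)) =Θ[atTop] (fun n => (D n : ℝ)) →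
      Tendsto (fun n : ℕ => randomPartite n (k n) (edgeProb n (D n))
          {G | ∀ π : TreeLikeThRefutation
              ⌊Real.logb 2 n / (2 * Real.logb 2 (Real.logb 2 n))⌋₊ (binaryClique G),
            (n : ℝ) ^ (c * (D n : ℝ)) ≤ (π.length : ℝ)})
        atTop (𝓝 1)) ∧
    (∀ ε : ℝ, 0 < ε → ε < 1 → ∀ D k : ℕ → ℕ,
      (∀ n : ℕ, D n = ⌈Real.logb 2 n ^ ε⌉₊) → (∀ n : ℕ, k n = 2 * D n) → ∀ s : ℕ,
      Tendsto (fun n : ℕ => randomPartite n (k n) (edgeProb n (D n))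
          {G | ¬ (binaryClique G).Satisfiable ∧
            ∀ d : ℕ, (d : ℝ) ≤ (Fintype.card (BVar (k n) n) : ℝ) ^ (1 - ε) →
              ∀ π : TreeLikeThRefutation d (binaryClique G),
                (binaryClique G).size ^ s ≤ π.length})
        atTop (𝓝 1)) := by
  refine ⟨⟨1 / 1600, by norm_num, fun D k hD hk => ?_⟩, fun ε hε0 hε1 D k hD hk s => ?_⟩
  · obtain ⟨C, hC0, hC⟩ := hk.1.exists_pos
    obtain ⟨C', -, hC'⟩ := hk.2.exists_pos
    have hkD : ∀ᶠ n : ℕ in atTop, (k n : ℝ) ≤ 2 * max C 1 * Real.logb 2 n := by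
      filter_upwards [hC.bound, hD] with n h1 h2
      rw [Real.norm_of_nonneg (Nat.cast_nonneg _), Real.norm_of_nonneg (Nat.cast_nonneg _)] at h1
      calc (k n : ℝ) ≤ C * D n := h1
        _ ≤ max C 1 * (2 * Real.logb 2 n) :=
            mul_le_mul (le_max_left _ _) h2.2 (Nat.cast_nonneg _) (by positivity)
        _ = _ := by ring
    refine tendsto_randomPartite_one (tendsto_of_tendsto_of_tendsto_of_le_of_le tendsto_const_nhds
      (tendsto_randomPartite_short_refutation hD ?_
        (eventually_card_lowDegreeMonomials_le (C := 2 * max C 1) ?_ hkD))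
      (fun _ => zero_le) fun n => MeasureTheory.measure_mono fun G hG => ?_)
    · filter_upwards [hC'.bound, hD, hkD, tendsto_logb_natCast.eventually_ge_atTop (2 * max C 1)]
        with n h1 h2 h3 h4
      -- The lower half of `k = Θ(D)` serves only to exclude k = 0.
      refine ⟨Nat.one_le_iff_ne_zero.2 fun h0 => ?_, ?_⟩
      · rw [h0, Nat.cast_zero, norm_zero, mul_zero, norm_le_zero_iff, Nat.cast_eq_zero] at h1
        omega
      · have : (1 : ℝ) ≤ max C 1 := le_max_right _ _
        rw [sq]
        exact h3.trans (mul_le_mul_of_nonneg_right h4 (by linarith))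
    · linarith [le_max_right C 1]
    · simp only [Set.mem_compl_iff, Set.mem_ofPred_eq, not_forall, not_le] at hG
      obtain ⟨π, hπ⟩ := hG
      exact ⟨π, hπ.trans_eq (by congr 1; ring)⟩
  · have hpow : Tendsto (fun n : ℕ => Real.logb 2 n ^ ε) atTop atTop :=
      (tendsto_rpow_atTop hε0).comp tendsto_logb_natCast
    have hDge : ∀ n : ℕ, Real.logb 2 n ^ ε ≤ D n := fun n => by
      rw [hD]
      exact Nat.le_ceil _
    have hDle : ∀ᶠ n : ℕ in atTop, (D n : ℝ) ≤ 2 * Real.logb 2 n ^ ε := by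
      filter_upwards [hpow.eventually_ge_atTop 1] with n h1
      rw [hD]
      linarith [Nat.ceil_lt_add_one (zero_le_one.trans h1)]
    have hkle : ∀ᶠ n : ℕ in atTop, (k n : ℝ) ≤ 4 * Real.logb 2 n ^ ε := by
      filter_upwards [hDle] with n h1
      rw [hk]
      push_cast
      linarith
    have hεx : ∀ᶠ n : ℕ in atTop, Real.logb 2 n ^ ε ≤ Real.logb 2 n := by
      filter_upwards [tendsto_logb_natCast.eventually_ge_atTop 1] with n h1
      calc Real.logb 2 n ^ ε ≤ Real.logb 2 n ^ (1 : ℝ) :=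
            Real.rpow_le_rpow_of_exponent_le h1 hε1.le
        _ = _ := Real.rpow_one _
    have hDbig : ∀ m : ℕ, ∀ᶠ n : ℕ in atTop, m ≤ D n := by
      intro m
      filter_upwards [hpow.eventually_ge_atTop m] with n h1
      exact_mod_cast h1.trans (hDge n)
    have hkbound : ∀ᶠ n : ℕ in atTop, 1 ≤ k n ∧ (k n : ℝ) ≤ Real.logb 2 n ^ 2 := by
      filter_upwards [hDbig 1, hkle, hεx, tendsto_logb_natCast.eventually_ge_atTop 4]
        with n h1 h2 h3 h4
      refine ⟨by rw [hk]; omega, ?_⟩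
      nlinarith
    have hshort := tendsto_randomPartite_short_refutation (D := D) (k := k)
      (d := fun n => ⌊(Fintype.card (BVar (k n) n) : ℝ) ^ (1 - ε)⌋₊) (by
        filter_upwards [hDbig 1, hDle, hεx] with n h1 h2 h3
        exact ⟨h1, by linarith⟩) hkbound
      (eventually_card_lowDegreeMonomials_rpow_le hε0 hε1 hkle)
    have hsum := hshort.add (tendsto_randomPartite_satisfiable (hDbig 2) hk)
    rw [add_zero] at hsum
    refine tendsto_randomPartite_one (tendsto_of_tendsto_of_tendsto_of_le_of_le' tendsto_const_nhds
      hsum (Eventually.of_forall fun _ => zero_le) ?_)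
    -- The size is at most n^3, so its s-th power is at most n^(3s) ≤ n^(D/1600) as soon as D ≥ 4800
    -- s.
    filter_upwards [hDbig (4800 * s), hkbound, eventually_gt_atTop 0,
      tendsto_logb_natCast.eventually_ge_atTop 1, tendsto_logb_natCast.eventually
      (eventually_pow_le_two_rpow 16 5 one_pos)] with n hDs hkb hn hx h16
    rw [one_mul] at h16
    refine (MeasureTheory.measure_mono fun G hG => ?_).trans (MeasureTheory.measure_union_le _ _)
    by_cases hsat : (binaryClique G).Satisfiable
    · exact Or.inr hsat
    · refine Or.inl ?_
      simp only [Set.mem_compl_iff, Set.mem_ofPred_eq, not_and, not_forall, not_le] at hG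
      obtain ⟨d, hd, π, hπ⟩ := hG hsat
      -- All degrees are handled by one event, since a refutation of smaller degree is also one of
      -- the maximal degree.
      refine ⟨π.ofLE (Nat.le_floor hd), ?_⟩
      change (π.length : ℝ) < _
      have hn1 : (1 : ℝ) ≤ n := by exact_mod_cast hn
      calc (π.length : ℝ) < ((binaryClique G).size : ℝ) ^ s := by exact_mod_cast hπ
        _ ≤ ((n : ℝ) ^ 3) ^ s := pow_le_pow_left₀ (Nat.cast_nonneg _)
            (size_binaryClique_le_pow hn hx hkb.2 h16 G) s
        _ = (n : ℝ) ^ ((3 * s : ℕ) : ℝ) := by rw [← pow_mul, Real.rpow_natCast]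
        _ ≤ _ := by
            refine Real.rpow_le_rpow_of_exponent_le hn1 ?_
            have : ((4800 * s : ℕ) : ℝ) ≤ D n := by exact_mod_cast hDs
            push_cast at this ⊢
            linarith
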